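/- Let $H$ be a complex Hilbert space and let $\mathcal L$ be a (possibly unbounded) skew-Hermitian operator on $H$, i.e. $\mathcal L$ is densely defined and $\mathcal L^{*}=-\mathcal L$ (including equality of domains). Let $\tau>0$, $M\in\mathbb N$, and let $b_m,\alpha_m\in\mathbb C$ ($-M\le m\le M$) with $\operatorname{Re}\alpha_m\neq 0$. Put $$R_M(z)=\sum_{m=-M}^{M}\frac{b_m}{z-\alpha_m},\qquad R_M(\tau\mathcal L)=\sum_{m=-M}^{M}b_m\,(\tau\mathcal L-\alpha_m)^{-1},$$ and assume that $|R_M(ix)|\le 1$ for all $x\in\mathbb R$. Then: 1. $\mathcal L$ generates a unique strongly continuous one-parameter group $(e^{t\mathcal L})_{t\in\mathbb R}$ of bounded operators on $H$, and each $\tau\mathcal L-\alpha_m$ has a bounded, everywhere defined inverse, so that $e^{\tau\mathcal L}$ and $R_M(\tau\mathcal L)$ are well defined. 2. For all real $\Lambda>0$ and $\delta$ such that $|e^{ix}-R_M(ix)|\le\delta$ for every $x\in[-\tau\Lambda,\tau\Lambda]$, and for every $\mathbf u_0\in H$, $$\left\| e^{\tau\mathcal L}\mathbf u_0-\sum_{m=-M}^{M}b_m(\tau\mathcal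 L-\alpha_m)^{-1}\mathbf u_0\right\|\le \delta\,\|\mathbf u_0\|+2\,\|\mathbf u_0-\mathcal P_\Lambda\mathbf u_0\|,$$ where $\mathcal P_\Lambda$ is the orthogonal projection onto the closed linear span of the eigenvectors of $\mathcal L$ whose eigenvalue $\lambda$ satisfies $|\lambda|\le\Lambda$. The same bound holds with $\mathcal P_\Lambda$ replaced by the spectral projection $E([-\Lambda,\Lambda])$, where $E$ is the spectral measure of $\mathcal L$, that is, the projection-valued measure on $\mathbb R$ with $\mathcal L=\int i s\,dE(s)$. 3. Repeated application of $R_M(\tau\mathcal L)$ is stable: $\|R_M(\tau\mathcal L)^n\|\le 1$ for every $n\in\mathbb N$. -/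

import Mathlib

open scoped InnerProductSpace

noncomputable section

namespace SkewExp

variable {H : Type*} [NormedAddCommGroup H] [InnerProductSpace ℂ H]

/-- A (possibly unbounded) operator is skew-Hermitian, in the operator-theoretic sense of
skew-adjoint: it is densely defined and its adjoint, domain included, is its negative. -/
def IsSkewHermitian [CompleteSpace H] (L : H →ₗ.[ℂ] H) : Prop :=
  Dense (L.domain : Set H) ∧ L.adjoint = -L

/-- `U` is the strongly continuous one-parameter group with infinitesimal generator `L`:
the pair `(x, y)` lies in the graph of `L` exactly when `t ↦ U t x` has derivative `y` at `0`. -/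
structure IsGroupGeneratedBy (L : H →ₗ.[ℂ] H) (U : ℝ → H →L[ℂ] H) : Prop where
  zero : U 0 = 1
  add : ∀ s t : ℝ, U (s + t) = U s * U t
  continuous : ∀ x : H, Continuous fun t : ℝ => U t x
  generator : ∀ x y : H, (x, y) ∈ L.graph ↔ HasDerivAt (fun t : ℝ => U t x) y 0

open Classical in
/-- The operator exponential `e ^ (t L)`: the value at time `t` of the strongly continuous group
generated by `L` (zero if there is no such group). -/
def opExp (L : H →ₗ.[ℂ] H) : ℝ → H →L[ℂ] H :=
  if h : ∃ U : ℝ → H →L[ℂ] H, IsGroupGeneratedBy L U then h.choose else 0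

/-- `B` is a bounded, everywhere defined two-sided inverse of `A - α`. -/
structure IsShiftInverse (A : H →ₗ.[ℂ] H) (α : ℂ) (B : H →L[ℂ] H) : Prop where
  right : ∀ f : H, ∃ h : B f ∈ A.domain, A ⟨B f, h⟩ - α • B f = f
  left : ∀ u : A.domain, B (A u - α • (u : H)) = u

open Classical in
/-- The bounded operator `(A - α)⁻¹` (zero if `A - α` has no bounded inverse). -/
def shiftInverse (A : H →ₗ.[ℂ] H) (α : ℂ) : H →L[ℂ] H :=
  if h : ∃ B : H →L[ℂ] H, IsShiftInverse A α B then h.choose else 0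

/-- The scalar rational function `R_M(z) = ∑_{m=-M}^{M} b_m / (z - α_m)`. -/
def ratFun (M : ℕ) (b α : ℤ → ℂ) (z : ℂ) : ℂ :=
  ∑ m ∈ Finset.Icc (-(M : ℤ)) M, b m / (z - α m)

/-- The operator `R_M(A) = ∑_{m=-M}^{M} b_m (A - α_m)⁻¹`. -/
def ratOp (M : ℕ) (b α : ℤ → ℂ) (A : H →ₗ.[ℂ] H) : H →L[ℂ] H :=
  ∑ m ∈ Finset.Icc (-(M : ℤ)) M, b m • shiftInverse A (α m)

/-- The closed linear span of the eigenvectors of `L` whose eigenvalue has modulus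
at most `Λ`. -/
def eigenmodes (L : H →ₗ.[ℂ] H) (Λ : ℝ) : Submodule ℂ H :=
  (Submodule.span ℂ
    {v : H | ∃ h : v ∈ L.domain, ∃ μ : ℂ, ‖μ‖ ≤ Λ ∧ L ⟨v, h⟩ = μ • v}).topologicalClosure

/-- The orthogonal projection onto the closed span of the eigenvectors of `L` whose eigenvalue has
modulus at most `Λ`. -/
def modeProj [CompleteSpace H] (L : H →ₗ.[ℂ] H) (Λ : ℝ) : H →L[ℂ] H :=
  haveI : CompleteSpace (eigenmodes L Λ) :=
    (Submodule.isClosed_topologicalClosure _).completeSpace_coe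
  (eigenmodes L Λ).starProjection

/-- `E` is the spectral measure of the skew-Hermitian operator `L`: a projection-valued measure on
the Borel sets of `ℝ` with `L = ∫ i s dE(s)`. With `μ_x(S) = ‖E(S) x‖²`, the last field says that
the domain of `L` consists of the `x` with `∫ s² dμ_x < ∞`, and that
`⟪x, L x⟫ = i ∫ s dμ_x` there. -/
structure IsSpectralMeasure [CompleteSpace H] (L : H →ₗ.[ℂ] H) (E : Set ℝ → H →L[ℂ] H) :
    Prop where
  proj : ∀ S : Set ℝ, MeasurableSet S → IsStarProjection (E S)
  univ : E Set.univ = 1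
  inter : ∀ S T : Set ℝ, MeasurableSet S → MeasurableSet T → E (S ∩ T) = E S * E T
  iUnion : ∀ S : ℕ → Set ℝ, (∀ n, MeasurableSet (S n)) → Pairwise (Function.onFun Disjoint S) →
    ∀ x : H, HasSum (fun n => E (S n) x) (E (⋃ n, S n) x)
  represents : ∀ x : H, ∃ μ : MeasureTheory.Measure ℝ,
    (∀ S : Set ℝ, MeasurableSet S → μ S = ENNReal.ofReal (‖E S x‖ ^ 2)) ∧
    (x ∈ L.domain ↔ MeasureTheory.Integrable (fun s : ℝ => s ^ 2) μ) ∧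
    ∀ h : x ∈ L.domain, ⟪x, L ⟨x, h⟩⟫_ℂ = Complex.I * ((∫ s, s ∂μ : ℝ) : ℂ)

end SkewExp

end

/-! Everything reduces to bounded operators. Skew-adjointness makes `L - 1` and `L + 1` bijective
with `‖(L - 1) x‖ = ‖(L + 1) x‖`, so `B = (L - 1)⁻¹` is bounded and the Cayley transform `V = 1 + 2
B` is unitary (`IsSkewHermitian.exists_isCayley`). A function `f` of `L` becomes `z ↦ f ((z + 1) /
(z - 1))` of `V`, where `(z + 1) / (z - 1)` is imaginary for `‖z‖ = 1` and `z = 1` plays the role of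
infinity. Resolvents have continuous symbols, so the continuous functional calculus constructs them
and turns `|R_M| ≤ 1` on the imaginary axis into `‖R_M(τL)‖ ≤ 1`. The exponential has no limit at `z
= 1`, but its product with the symbol of `B` is continuous; this gives `e ^ (t L) B`, hence `e ^ (t
L)` by density of the range of `B`.

For the error bound, let `K` be a closed subspace on which `L` acts as an operator `S` of norm at
most `Λ`. Then `S` is bounded and skew-adjoint, its spectrum lies in `i [-Λ, Λ]`, and the functional
calculus of `S` bounds the error on `K` by `δ`. Writing `u = P u + (u - P u)` with `P` a contraction
into `K`, the remainder costs a factor 2 because `e ^ (τ L)` and `R_M(τL)` are both contractions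
(`IsSkewHermitian.norm_opExp_sub_ratOp_le_projection`).

It remains to check that `L` is bounded by `Λ` on the two subspaces:
`IsSkewHermitian.isBoundedOn_eigenmodes` uses orthogonality of eigenspaces,
`IsSpectralMeasure.isBoundedOn_range` uses only the quadratic form of `L`. -/

noncomputable section

namespace SkewExp

variable {H : Type*} [NormedAddCommGroup H] [InnerProductSpace ℂ H]

/-! ### The graph of a skew-adjoint operator and its Cayley transform -/

section Graph

theorem graph_apply {L : H →ₗ.[ℂ] H} {x : H} (h : x ∈ L.domain) : (x, L ⟨x, h⟩) ∈ L.graph :=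
  (L.mem_graph_iff).2 ⟨⟨x, h⟩, rfl, rfl⟩

theorem mem_domain_of_graph {L : H →ₗ.[ℂ] H} {x y : H} (h : (x, y) ∈ L.graph) :
    ∃ hx : x ∈ L.domain, L ⟨x, hx⟩ = y := by
  obtain ⟨⟨u, hu⟩, h1, h2⟩ := (L.mem_graph_iff).1 h
  obtain rfl : u = x := h1
  exact ⟨hu, h2⟩

section Complete

variable [CompleteSpace H] {L : H →ₗ.[ℂ] H}

/-- The graph of a skew-Hermitian operator is its own annihilator under the pairing
`⟪y, u⟫ + ⟪x, v⟫`. -/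
theorem IsSkewHermitian.mem_graph_iff (hL : IsSkewHermitian L) {x y : H} :
    (x, y) ∈ L.graph ↔ ∀ u v : H, (u, v) ∈ L.graph → ⟪y, u⟫_ℂ + ⟪x, v⟫_ℂ = 0 := by
  obtain ⟨hd, ha⟩ := hL
  constructor
  · intro h u v huv
    obtain ⟨hx, rfl⟩ := mem_domain_of_graph h
    obtain ⟨hu, rfl⟩ := mem_domain_of_graph huv
    have hF : (-L).IsFormalAdjoint L := ha ▸ LinearPMap.adjoint_isFormalAdjoint hd
    have := hF ⟨x, hx⟩ ⟨u, hu⟩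
    simp only [LinearPMap.neg_apply, inner_neg_left] at this
    rw [← this]
    exact add_neg_cancel _
  · intro h
    have key : ∀ u : L.domain, ⟪-y, (u : H)⟫_ℂ = ⟪x, L u⟫_ℂ := fun u => by
      have := h u (L u) (graph_apply u.2)
      rw [inner_neg_left]
      linear_combination -this
    have hx : x ∈ L.adjoint.domain := LinearPMap.mem_adjoint_domain_of_exists x ⟨-y, key⟩
    have hv : L.adjoint ⟨x, hx⟩ = -y := LinearPMap.adjoint_apply_eq hd ⟨x, hx⟩ key
    have hg : (x, -y) ∈ L.adjoint.graph := hv ▸ (L.adjoint.mem_graph_iff).2 ⟨⟨x, hx⟩, rfl, rfl⟩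
    rw [ha] at hg
    obtain ⟨u, h1, h2⟩ := ((-L).mem_graph_iff).1 hg
    refine (L.mem_graph_iff).2 ⟨u, h1, ?_⟩
    have h3 : -(L u) = -y := h2
    exact neg_inj.1 h3

theorem IsSkewHermitian.re_inner_eq_zero (hL : IsSkewHermitian L) {x y : H}
    (h : (x, y) ∈ L.graph) : (⟪x, y⟫_ℂ).re = 0 := by
  have := congrArg Complex.re (hL.mem_graph_iff.1 h x y h)
  have h2 : (⟪y, x⟫_ℂ).re = (⟪x, y⟫_ℂ).re := inner_re_symm (𝕜 := ℂ) y x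
  rw [Complex.add_re, h2, Complex.zero_re] at this
  linarith

theorem IsSkewHermitian.isClosed_graph (hL : IsSkewHermitian L) :
    IsClosed (L.graph : Set (H × H)) := by
  have : (L.graph : Set (H × H)) =
      ⋂ p : L.graph, {q : H × H | ⟪q.2, p.1.1⟫_ℂ + ⟪q.1, p.1.2⟫_ℂ = 0} := by
    ext ⟨x, y⟩
    rw [SetLike.mem_coe, hL.mem_graph_iff, Set.mem_iInter]
    exact ⟨fun h p => h _ _ p.2, fun h u v huv => h ⟨(u, v), huv⟩⟩
  rw [this]
  exact isClosed_iInter fun p => isClosed_eq (by fun_prop) continuous_const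

/-- The cross term vanishes because `⟪x, L x⟫` is imaginary. This identity yields injectivity and
closed range of `L ∓ 1`, the bound on `B` and the isometry of `V`. -/
theorem IsSkewHermitian.norm_sub_smul_sq (hL : IsSkewHermitian L) {x y : H}
    (h : (x, y) ∈ L.graph) (a : ℝ) :
    ‖y - (a : ℂ) • x‖ ^ 2 = ‖y‖ ^ 2 + a ^ 2 * ‖x‖ ^ 2 := by
  rw [norm_sub_sq (𝕜 := ℂ), inner_smul_right, norm_smul, mul_pow]
  have h2 : (⟪y, x⟫_ℂ).re = 0 := by
    rw [← hL.re_inner_eq_zero h]; exact inner_re_symm (𝕜 := ℂ) y x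
  simp [h2]

/-- On the graph, a Banach space, `L - a` is bounded and bounded below, so its range is closed. A
vector `y` orthogonal to the range satisfies `L y = -a y`, which the norm identity with `-a` forces
to be zero. -/
theorem IsSkewHermitian.surjective_sub_smul (hL : IsSkewHermitian L) {a : ℝ} (ha : a ^ 2 = 1)
    (f : H) : ∃ x y : H, (x, y) ∈ L.graph ∧ y - (a : ℂ) • x = f := by
  let T : L.graph →L[ℂ] H :=
    (ContinuousLinearMap.snd ℂ H H - (a : ℂ) • ContinuousLinearMap.fst ℂ H H).comp
      L.graph.subtypeL
  have hT : ∀ p : L.graph, T p = p.1.2 - (a : ℂ) • p.1.1 := fun p => rfl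
  have : CompleteSpace L.graph := hL.isClosed_graph.completeSpace_coe
  have hanti : AntilipschitzWith 1 T := by
    refine AddMonoidHomClass.antilipschitz_of_bound T fun p => ?_
    have h1 := hL.norm_sub_smul_sq (x := p.1.1) (y := p.1.2) p.2 a
    rw [ha] at h1
    change ‖p.1‖ ≤ (1 : NNReal) * ‖T p‖
    rw [hT, NNReal.coe_one, one_mul, Prod.norm_def, max_le_iff]
    constructor <;> apply (sq_le_sq₀ (norm_nonneg _) (norm_nonneg _)).1 <;>
      nlinarith [sq_nonneg ‖p.1.1‖, sq_nonneg ‖p.1.2‖]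
  have hcl : IsClosed (LinearMap.range T.toLinearMap : Set H) :=
    hanti.isClosed_range T.uniformContinuous
  have : CompleteSpace (LinearMap.range T.toLinearMap) := hcl.completeSpace_coe
  have htop : LinearMap.range T.toLinearMap = ⊤ := by
    rw [← Submodule.orthogonal_eq_bot_iff, Submodule.eq_bot_iff]
    intro y hy
    have hg : (y, -(a : ℂ) • y) ∈ L.graph := by
      rw [hL.mem_graph_iff]
      intro u v huv
      have := (Submodule.mem_orthogonal' _ _).1 hy (T ⟨(u, v), huv⟩) ⟨_, rfl⟩
      rw [hT, inner_sub_right, inner_smul_right] at this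
      rw [inner_smul_left, ← this]
      simp
      ring
    have h1 := hL.norm_sub_smul_sq hg (-a)
    have h2 : a ≠ 0 := by rintro rfl; norm_num at ha
    have h3 : ‖y‖ ^ 2 = 0 := by
      rw [Complex.ofReal_neg, sub_self, norm_zero, neg_sq, ha] at h1
      nlinarith [sq_nonneg ‖y‖, sq_nonneg ‖-(a : ℂ) • y‖]
    simpa using h3
  obtain ⟨p, hp⟩ : f ∈ LinearMap.range T.toLinearMap := htop ▸ Submodule.mem_top
  exact ⟨p.1.1, p.1.2, p.2, hp⟩

/-- The Cayley transform `V = (L + 1) (L - 1)⁻¹`, described by `(L - 1)⁻¹ = (V - 1) / 2`. -/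
structure IsCayley (L : H →ₗ.[ℂ] H) (B V : H →L[ℂ] H) : Prop where
  graph : ∀ f : H, (B f, f + B f) ∈ L.graph
  inv : ∀ x y : H, (x, y) ∈ L.graph → B (y - x) = x
  unitary : V ∈ unitary (H →L[ℂ] H)
  eq : B = (1 / 2 : ℂ) • (V - 1)

theorem IsSkewHermitian.exists_isCayley (hL : IsSkewHermitian L) :
    ∃ B V : H →L[ℂ] H, IsCayley L B V := by
  have hinj : ∀ x y x' y' : H, (x, y) ∈ L.graph → (x', y') ∈ L.graph → y - x = y' - x' →
      x = x' := by
    intro x y x' y' h h' he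
    have h1 := hL.norm_sub_smul_sq (L.graph.sub_mem h h') 1
    have h2 : (y - y') - ((1 : ℝ) : ℂ) • (x - x') = 0 := by
      rw [Complex.ofReal_one, one_smul, ← sub_eq_zero.2 he]; abel
    simp only at h1
    rw [h2] at h1
    have h3 : ‖x - x'‖ ^ 2 = 0 := by
      norm_num at h1
      nlinarith [sq_nonneg ‖x - x'‖, sq_nonneg ‖y - y'‖]
    exact sub_eq_zero.1 (by simpa using h3)
  have hsurj : ∀ f : H, ∃ x : H, (x, f + x) ∈ L.graph := by
    intro f
    obtain ⟨x, y, h, rfl⟩ := hL.surjective_sub_smul (a := 1) (by norm_num) f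
    exact ⟨x, by simpa using h⟩
  choose b hb using hsurj
  have hbu : ∀ x y, (x, y) ∈ L.graph → b (y - x) = x := fun x y h =>
    hinj _ _ _ _ (hb _) h (by abel)
  let Bl : H →ₗ[ℂ] H :=
    { toFun := b
      map_add' := fun f g => by
        have := hbu _ _ (L.graph.add_mem (hb f) (hb g))
        simp only at this
        rw [← this]; congr 1; abel
      map_smul' := fun c f => by
        have := hbu _ _ (L.graph.smul_mem c (hb f))
        simp only at this
        simp only [RingHom.id_apply]
        rw [← this]; congr 1; simp }
  have hnorm : ∀ f, ‖f‖ ^ 2 = ‖f + b f‖ ^ 2 + ‖b f‖ ^ 2 := fun f => by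
    simpa using hL.norm_sub_smul_sq (hb f) 1
  have hnorm' : ∀ f, ‖f + (b f + b f)‖ ^ 2 = ‖f + b f‖ ^ 2 + ‖b f‖ ^ 2 := fun f => by
    simpa [add_assoc] using hL.norm_sub_smul_sq (hb f) (-1)
  let B : H →L[ℂ] H := Bl.mkContinuous 1 fun f => by
    change ‖b f‖ ≤ 1 * ‖f‖
    rw [one_mul]
    apply (sq_le_sq₀ (norm_nonneg _) (norm_nonneg _)).1
    nlinarith [hnorm f, sq_nonneg ‖f + b f‖]
  -- With `x = B f`, one has `f = (L - 1) x` and `f + 2 B f = (L + 1) x`, which have equal norms.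
  let Vi : H →ₗᵢ[ℂ] H :=
    { toLinearMap := ((1 : H →L[ℂ] H) + (2 : ℂ) • B).toLinearMap
      norm_map' := fun f => by
        change ‖f + (2 : ℂ) • b f‖ = ‖f‖
        rw [two_smul, ← sq_eq_sq₀ (norm_nonneg _) (norm_nonneg _), hnorm', ← hnorm] }
  have hVs : Function.Surjective Vi := by
    intro g
    obtain ⟨x, y, h, rfl⟩ := hL.surjective_sub_smul (a := -1) (by norm_num) g
    refine ⟨y - x, ?_⟩
    change (y - x) + (2 : ℂ) • b (y - x) = _
    rw [hbu x y h, two_smul]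
    simp
  let Ve : H ≃ₗᵢ[ℂ] H := LinearIsometryEquiv.ofSurjective Vi hVs
  have hVe : ((Unitary.linearIsometryEquiv.symm Ve : unitary (H →L[ℂ] H)) : H →L[ℂ] H) =
      1 + (2 : ℂ) • B := by
    ext f
    rfl
  refine ⟨B, 1 + (2 : ℂ) • B, ?_, ?_, ?_, ?_⟩
  · exact hb
  · exact hbu
  · rw [← hVe]; exact SetLike.coe_mem _
  · simp [smul_smul]

end Complete

end Graph

/-! ### Resolvents and rational functions through the Cayley transform -/

section Resolvent

/-- The real part has numerator `‖z‖ ^ 2 - 1`. At `z = 1` the quotient is 0 by convention, so no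
exception is needed. -/
theorem exists_cayley_eq_I_mul {z : ℂ} (hz : ‖z‖ = 1) :
    ∃ x : ℝ, (z + 1) / (z - 1) = Complex.I * x := by
  refine ⟨((z + 1) / (z - 1)).im, ?_⟩
  have hn : z.re * z.re + z.im * z.im = 1 := by
    rw [← Complex.normSq_apply, Complex.normSq_eq_norm_sq, hz, one_pow]
  apply Complex.ext
  · simp only [Complex.div_re, Complex.add_re, Complex.one_re, Complex.sub_re, Complex.add_im,
      Complex.one_im, Complex.sub_im, Complex.mul_re, Complex.I_re, Complex.ofReal_re,
      Complex.I_im, Complex.ofReal_im]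
    rw [← add_div]
    have : (z.re + 1) * (z.re - 1) + (z.im + 0) * (z.im - 0) = 0 := by linarith
    rw [this]
    simp
  · simp

theorem cayley_denom_ne_zero {z : ℂ} (hz : ‖z‖ = 1) {τ : ℝ} (hτ : τ ≠ 0) {a : ℂ}
    (ha : a.re ≠ 0) : (τ : ℂ) * (z + 1) - a * (z - 1) ≠ 0 := by
  intro h
  have hτ' : (τ : ℂ) ≠ 0 := by exact_mod_cast hτ
  by_cases h1 : z = 1
  · subst h1
    norm_num at h
    exact hτ h
  · obtain ⟨x, hx⟩ := exists_cayley_eq_I_mul hz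
    have h2 : z - 1 ≠ 0 := sub_ne_zero.2 h1
    have h3 : a = τ * (Complex.I * x) := by
      rw [← hx]
      field_simp
      linear_combination -h
    apply ha
    rw [h3]
    simp

theorem mem_graph_smul {L : H →ₗ.[ℂ] H} {c : ℂ} {x y : H} (h : (x, y) ∈ L.graph) :
    (x, c • y) ∈ (c • L).graph := by
  obtain ⟨hx, rfl⟩ := mem_domain_of_graph h
  exact ((c • L).mem_graph_iff).2 ⟨⟨x, hx⟩, rfl, rfl⟩

theorem exists_of_mem_graph_smul {L : H →ₗ.[ℂ] H} {c : ℂ} {x y : H}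
    (h : (x, y) ∈ (c • L).graph) : ∃ w, (x, w) ∈ L.graph ∧ c • w = y := by
  obtain ⟨hx, rfl⟩ := mem_domain_of_graph h
  exact ⟨L ⟨x, hx⟩, graph_apply (L := L) hx, rfl⟩

theorem isShiftInverse_of_graph {A : H →ₗ.[ℂ] H} {α : ℂ} {R : H →L[ℂ] H}
    (h1 : ∀ f, (R f, f + α • R f) ∈ A.graph)
    (h2 : ∀ x y, (x, y) ∈ A.graph → R (y - α • x) = x) : IsShiftInverse A α R where
  right f := by
    obtain ⟨hx, he⟩ := mem_domain_of_graph (h1 f)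
    exact ⟨hx, by rw [he, add_sub_cancel_right]⟩
  left u := h2 _ _ (graph_apply u.2)

theorem IsShiftInverse.apply_eq {A : H →ₗ.[ℂ] H} {α : ℂ} {R : H →L[ℂ] H}
    (hR : IsShiftInverse A α R) {x y : H} (h : (x, y) ∈ A.graph) : R (y - α • x) = x := by
  obtain ⟨hx, rfl⟩ := mem_domain_of_graph h
  exact hR.left ⟨x, hx⟩

theorem IsShiftInverse.unique {A : H →ₗ.[ℂ] H} {α : ℂ} {R R' : H →L[ℂ] H}
    (hR : IsShiftInverse A α R) (hR' : IsShiftInverse A α R') : R = R' := by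
  ext f
  obtain ⟨h, he⟩ := hR.right f
  have := hR'.left ⟨R f, h⟩
  rw [he] at this
  exact this.symm

theorem IsShiftInverse.shiftInverse {A : H →ₗ.[ℂ] H} {α : ℂ} {R : H →L[ℂ] H}
    (hR : IsShiftInverse A α R) : IsShiftInverse A α (shiftInverse A α) := by
  have h : ∃ B : H →L[ℂ] H, IsShiftInverse A α B := ⟨R, hR⟩
  rw [SkewExp.shiftInverse, dif_pos h]
  exact h.choose_spec

variable [CompleteSpace H] {L : H →ₗ.[ℂ] H} {B V : H →L[ℂ] H}

theorem IsCayley.isStarNormal (h : IsCayley L B V) : IsStarNormal V :=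
  isStarNormal_of_mem_unitary h.unitary

theorem IsCayley.norm_eq_one (h : IsCayley L B V) {z : ℂ} (hz : z ∈ spectrum ℂ V) : ‖z‖ = 1 := by
  simpa using spectrum.subset_circle_of_unitary h.unitary hz

theorem IsCayley.cfc_eq (h : IsCayley L B V) : cfc (fun z : ℂ => (1 / 2 : ℂ) * (z - 1)) V = B := by
  have := h.isStarNormal
  rw [cfc_const_mul _ _ _ (by fun_prop), cfc_sub _ _ _ (by fun_prop) (by fun_prop), cfc_id' ℂ V,
    cfc_const_one ℂ V, h.eq]

theorem IsCayley.continuousOn_resolvent (h : IsCayley L B V) {τ : ℝ} (hτ : τ ≠ 0) {a : ℂ}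
    (ha : a.re ≠ 0) :
    ContinuousOn (fun z : ℂ => (z - 1) / ((τ : ℂ) * (z + 1) - a * (z - 1))) (spectrum ℂ V) :=
  ContinuousOn.div (by fun_prop) (by fun_prop) fun z hz =>
    cayley_denom_ne_zero (h.norm_eq_one hz) hτ ha

/-- The symbol is `1 / (τ λ - a)` at `λ = (z + 1) / (z - 1)`. It factors as `B * G`, where `G`
inverts the bounded operator `(τ L - a) B = τ + (τ - a) B`. -/
theorem IsCayley.isShiftInverse (h : IsCayley L B V) {τ : ℝ} (hτ : τ ≠ 0) {a : ℂ}
    (ha : a.re ≠ 0) :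
    IsShiftInverse ((τ : ℂ) • L) a
      (cfc (fun z : ℂ => (z - 1) / ((τ : ℂ) * (z + 1) - a * (z - 1))) V) := by
  have hN := h.isStarNormal
  have hD : ∀ z ∈ spectrum ℂ V, (τ : ℂ) * (z + 1) - a * (z - 1) ≠ 0 := fun z hz =>
    cayley_denom_ne_zero (h.norm_eq_one hz) hτ ha
  set g : ℂ → ℂ := fun z => 2 / ((τ : ℂ) * (z + 1) - a * (z - 1)) with hg
  have hgc : ContinuousOn g (spectrum ℂ V) := ContinuousOn.div (by fun_prop) (by fun_prop) hD
  set G := cfc g V with hG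
  have hBG : cfc (fun z : ℂ => (z - 1) / ((τ : ℂ) * (z + 1) - a * (z - 1))) V = B * G := by
    rw [← h.cfc_eq, hG, ← cfc_mul _ _ V (by fun_prop) hgc]
    refine cfc_congr fun z _ => ?_
    simp only [hg]
    ring
  have hcomm : B * G = G * B := by
    rw [← h.cfc_eq]
    exact cfc_commute_cfc _ _ V
  have hid : G * ((τ : ℂ) • 1 + ((τ : ℂ) - a) • B) = 1 := by
    have e1 : (τ : ℂ) • (1 : H →L[ℂ] H) + ((τ : ℂ) - a) • B =
        cfc (fun z : ℂ => (τ : ℂ) * 1 + ((τ : ℂ) - a) * ((1 / 2 : ℂ) * (z - 1))) V := by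
      rw [cfc_add _ _ _ (by fun_prop) (by fun_prop), cfc_const_mul _ _ _ (by fun_prop),
        cfc_const_mul _ _ _ (by fun_prop), h.cfc_eq, cfc_const_one ℂ V]
    rw [e1, hG, ← cfc_mul _ _ V hgc (by fun_prop), ← cfc_const_one ℂ V]
    refine cfc_congr fun z hz => ?_
    have := hD z hz
    simp only [hg]
    field_simp
    ring
  have hid' : ∀ f, G ((τ : ℂ) • f + ((τ : ℂ) - a) • B f) = f := fun f => by
    simpa using DFunLike.congr_fun hid f
  have hcomm' : ∀ f, B (G f) = G (B f) := fun f => DFunLike.congr_fun hcomm f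
  rw [hBG]
  apply isShiftInverse_of_graph
  · intro f
    have h1 := mem_graph_smul (c := (τ : ℂ)) (h.graph (G f))
    have h2 : (τ : ℂ) • (G f + B (G f)) = f + a • B (G f) := by
      have h3 := hid' f
      rw [map_add, map_smul, map_smul, ← hcomm' f] at h3
      calc _ = ((τ : ℂ) • G f + ((τ : ℂ) - a) • B (G f)) + a • B (G f) := by module
        _ = _ := by rw [h3]
    rw [h2] at h1
    exact h1
  · intro x y hxy
    obtain ⟨w, hw, rfl⟩ := exists_of_mem_graph_smul hxy
    have h1 := h.inv x w hw
    have h2 : (τ : ℂ) • w - a • x = (τ : ℂ) • (w - x) + ((τ : ℂ) - a) • B (w - x) := by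
      rw [h1]; module
    rw [h2]
    change B (G _) = x
    rw [hid', h1]

theorem IsSkewHermitian.isShiftInverse (hL : IsSkewHermitian L) {τ : ℝ} (hτ : τ ≠ 0) {a : ℂ}
    (ha : a.re ≠ 0) : IsShiftInverse ((τ : ℂ) • L) a (shiftInverse ((τ : ℂ) • L) a) := by
  obtain ⟨B, V, h⟩ := hL.exists_isCayley
  exact (h.isShiftInverse hτ ha).shiftInverse

theorem IsSkewHermitian.norm_ratOp_le (hL : IsSkewHermitian L) {τ : ℝ} (hτ : τ ≠ 0) {M : ℕ}
    {b α : ℤ → ℂ} (hα : ∀ m ∈ Finset.Icc (-(M : ℤ)) M, (α m).re ≠ 0)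
    (hR : ∀ x : ℝ, ‖ratFun M b α (Complex.I * x)‖ ≤ 1) :
    ‖ratOp M b α ((τ : ℂ) • L)‖ ≤ 1 := by
  obtain ⟨B, V, h⟩ := hL.exists_isCayley
  have hN := h.isStarNormal
  have hop : ratOp M b α ((τ : ℂ) • L) = cfc (∑ m ∈ Finset.Icc (-(M : ℤ)) M, fun z : ℂ =>
      b m * ((z - 1) / ((τ : ℂ) * (z + 1) - α m * (z - 1)))) V := by
    have hc : ∀ m ∈ Finset.Icc (-(M : ℤ)) M, ContinuousOn (fun z : ℂ =>
        b m * ((z - 1) / ((τ : ℂ) * (z + 1) - α m * (z - 1)))) (spectrum ℂ V) := fun m hm =>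
      continuousOn_const.mul (h.continuousOn_resolvent hτ (hα m hm))
    rw [cfc_sum _ _ _ hc, ratOp]
    refine Finset.sum_congr rfl fun m hm => ?_
    rw [cfc_const_mul _ _ _ (h.continuousOn_resolvent hτ (hα m hm)),
      (hL.isShiftInverse hτ (hα m hm)).unique (h.isShiftInverse hτ (hα m hm))]
  rw [hop]
  refine norm_cfc_le zero_le_one fun z hz => ?_
  rw [Finset.sum_apply]
  -- At `z = 1`, the point at infinity, every summand vanishes; elsewhere the sum is `R_M` at an
  -- imaginary point.
  by_cases h1 : z = 1
  · subst h1; simp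
  · obtain ⟨x, hx⟩ := exists_cayley_eq_I_mul (h.norm_eq_one hz)
    have h2 : z - 1 ≠ 0 := sub_ne_zero.2 h1
    refine le_of_eq_of_le (congrArg _ ?_) (hR (τ * x))
    refine Finset.sum_congr rfl fun m hm => ?_
    have h3 : Complex.I * ((τ * x : ℝ) : ℂ) = τ * ((z + 1) / (z - 1)) := by
      rw [hx]; push_cast; ring
    rw [h3, div_eq_mul_inv (b m)]
    congr 1
    rw [← inv_div]
    congr 1
    field_simp

theorem norm_pow_le_one_of_norm_le_one {T : H →L[ℂ] H} (hT : ‖T‖ ≤ 1) (n : ℕ) : ‖T ^ n‖ ≤ 1 := by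
  induction n with
  | zero => rw [pow_zero]; exact ContinuousLinearMap.norm_id_le
  | succ n ih =>
    rw [pow_succ]
    exact (norm_mul_le _ _).trans (mul_le_one₀ ih (norm_nonneg _) hT)

end Resolvent

/-! ### The regularized exponential symbol on the unit circle -/

section ExpSymbol

open Filter Topology

theorem tendsto_apply_of_denseRange {ι : Type*} {l : Filter ι} {S : ι → H →L[ℂ] H}
    {S₀ D : H →L[ℂ] H} (hD : DenseRange D) {C : ℝ} (hC : ∀ i, ‖S i‖ ≤ C)
    (h : ∀ y, Tendsto (fun i => S i (D y)) l (𝓝 (S₀ (D y)))) (x : H) :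
    Tendsto (fun i => S i x) l (𝓝 (S₀ x)) := by
  rcases isEmpty_or_nonempty ι with hι | ⟨⟨i₀⟩⟩
  · rw [Filter.filter_eq_bot_of_isEmpty l]; exact tendsto_bot
  have hC0 : 0 ≤ C := (norm_nonneg _).trans (hC i₀)
  rw [Metric.tendsto_nhds]
  intro ε hε
  set K := C + ‖S₀‖ + 1 with hK
  have hK0 : 0 < K := by positivity
  obtain ⟨y, hy⟩ := hD.exists_dist_lt x (ε := ε / (2 * K)) (by positivity)
  filter_upwards [(Metric.tendsto_nhds.1 (h y)) (ε / 2) (by positivity)] with i hi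
  rw [dist_eq_norm] at *
  have e : S i x - S₀ x = S i (x - D y) - S₀ (x - D y) + (S i (D y) - S₀ (D y)) := by
    simp only [map_sub]; abel
  have h1 : ‖S i (x - D y)‖ ≤ C * ‖x - D y‖ := (S i).le_of_opNorm_le (hC i) _
  have h2 : ‖S₀ (x - D y)‖ ≤ ‖S₀‖ * ‖x - D y‖ := S₀.le_opNorm _
  have h3 : K * ‖x - D y‖ < ε / 2 := by
    rw [lt_div_iff₀ (by positivity)] at hy
    linarith
  have h4 : (C + ‖S₀‖) * ‖x - D y‖ ≤ K * ‖x - D y‖ := by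
    gcongr; linarith
  rw [e]
  calc _ ≤ ‖S i (x - D y)‖ + ‖S₀ (x - D y)‖ + ‖S i (D y) - S₀ (D y)‖ :=
        (norm_add_le _ _).trans (by gcongr; exact norm_sub_le _ _)
    _ < ε := by linarith

/-- Taylor's estimate covers `|x| ≤ 1`; for larger `|x|` the crude bound `2 |x|` is already below `2
x ^ 2`. -/
theorem norm_exp_I_mul_sub_one_sub_le (x : ℝ) :
    ‖Complex.exp (Complex.I * x) - 1 - Complex.I * x‖ ≤ 2 * x ^ 2 := by
  have hn : ‖Complex.I * (x : ℂ)‖ = |x| := by simp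
  rcases le_total |x| 1 with h | h
  · refine (Complex.norm_exp_sub_one_sub_id_le (hn.trans_le h)).trans ?_
    rw [hn, sq_abs]
    nlinarith [sq_nonneg x]
  · refine (norm_sub_le _ _).trans ?_
    have := Real.norm_exp_I_mul_ofReal_sub_one_le (x := x)
    rw [hn]
    rw [Real.norm_eq_abs] at this
    nlinarith [sq_abs x]

/-- The function of the Cayley transform `V` representing `e ^ (t L) (L - 1)⁻¹`. -/
def cayleyExp (t : ℝ) (z : ℂ) : ℂ :=
  (1 / 2 : ℂ) * (z - 1) * Complex.exp (t * ((z + 1) / (z - 1)))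

theorem norm_exp_cayley {z : ℂ} (hz : ‖z‖ = 1) (t : ℝ) :
    ‖Complex.exp (t * ((z + 1) / (z - 1)))‖ = 1 := by
  obtain ⟨x, hx⟩ := exists_cayley_eq_I_mul hz
  rw [hx, ← mul_assoc, mul_comm _ Complex.I, mul_assoc, ← Complex.ofReal_mul, mul_comm]
  exact Complex.norm_exp_ofReal_mul_I _

/-- Near `z = 1` the exponential oscillates but has modulus 1, so the factor `z - 1` forces the
limit 0. -/
theorem continuousOn_cayleyExp (t : ℝ) {s : Set ℂ} (hs : ∀ z ∈ s, ‖z‖ = 1) :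
    ContinuousOn (cayleyExp t) s := by
  intro z hz
  by_cases h1 : z = 1
  · subst h1
    have h0 : cayleyExp t 1 = 0 := by simp [cayleyExp]
    rw [ContinuousWithinAt, h0]
    have hb : ∀ w ∈ s, ‖cayleyExp t w‖ ≤ ‖w - 1‖ := fun w hw => by
      rw [cayleyExp, norm_mul, norm_exp_cayley (hs w hw), mul_one, norm_mul]
      have : ‖(1 / 2 : ℂ)‖ = 1 / 2 := by norm_num
      rw [this]
      linarith [norm_nonneg (w - 1)]
    refine squeeze_zero_norm' (eventually_mem_nhdsWithin.mono hb) ?_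
    have : Tendsto (fun w : ℂ => ‖w - 1‖) (𝓝 1) (𝓝 ‖(1 : ℂ) - 1‖) :=
      (by fun_prop : Continuous fun w : ℂ => ‖w - 1‖).tendsto 1
    rw [sub_self, norm_zero] at this
    exact this.mono_left nhdsWithin_le_nhds
  · have h2 : z - 1 ≠ 0 := sub_ne_zero.2 h1
    apply ContinuousAt.continuousWithinAt
    unfold cayleyExp
    have : ContinuousAt (fun w : ℂ => (w + 1) / (w - 1)) z :=
      ContinuousAt.div (by fun_prop) (by fun_prop) h2
    fun_prop

/-- The scalar form of boundedness of `L B`: each factor `B` absorbs one power of `x`. One factor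
thus gives the Lipschitz bound in `t`, and two give the second-order Taylor bound, both uniformly in
`z`. -/
theorem norm_half_mul_sub_one_mul_le {z : ℂ} (hz : ‖z‖ = 1) {x : ℝ}
    (hx : (z + 1) / (z - 1) = Complex.I * x) : ‖(1 / 2 : ℂ) * (z - 1)‖ * |x| ≤ 1 := by
  have h : ‖(z + 1) / (z - 1)‖ = |x| := by rw [hx]; simp
  have h12 : ‖(1 / 2 : ℂ)‖ = 1 / 2 := by norm_num
  rw [← h, ← norm_mul]
  by_cases h1 : z = 1
  · subst h1; simp
  · have h2 : z - 1 ≠ 0 := sub_ne_zero.2 h1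
    have : (1 / 2 : ℂ) * (z - 1) * ((z + 1) / (z - 1)) = (1 / 2) * (z + 1) := by field_simp
    rw [this, norm_mul, h12]
    have := norm_add_le z 1
    rw [hz, norm_one] at this
    linarith

theorem norm_cayleyExp_sub_le {z : ℂ} (hz : ‖z‖ = 1) (s t : ℝ) :
    ‖cayleyExp t z - cayleyExp s z‖ ≤ |t - s| := by
  obtain ⟨x, hx⟩ := exists_cayley_eq_I_mul hz
  have e : cayleyExp t z - cayleyExp s z = (1 / 2 : ℂ) * (z - 1) *
      (Complex.exp (s * ((z + 1) / (z - 1))) *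
        (Complex.exp (Complex.I * ((t - s) * x : ℝ)) - 1)) := by
    have h1 : (t : ℂ) * ((z + 1) / (z - 1)) =
        s * ((z + 1) / (z - 1)) + Complex.I * ((t - s) * x : ℝ) := by
      rw [hx]; push_cast; ring
    rw [cayleyExp, cayleyExp, h1, Complex.exp_add]
    ring
  rw [e, norm_mul, norm_mul (Complex.exp _), norm_exp_cayley hz, one_mul]
  have h1 := Real.norm_exp_I_mul_ofReal_sub_one_le (x := (t - s) * x)
  rw [Real.norm_eq_abs, abs_mul] at h1
  calc _ ≤ ‖(1 / 2 : ℂ) * (z - 1)‖ * (|t - s| * |x|) := by gcongr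
    _ = (‖(1 / 2 : ℂ) * (z - 1)‖ * |x|) * |t - s| := by ring
    _ ≤ 1 * |t - s| := by gcongr; exact norm_half_mul_sub_one_mul_le hz hx
    _ = _ := one_mul _

theorem norm_cayleyExp_taylor_le {z : ℂ} (hz : ‖z‖ = 1) (t : ℝ) :
    ‖(1 / 2 : ℂ) * (z - 1) * cayleyExp t z - (1 / 2 : ℂ) * (z - 1) * ((1 / 2 : ℂ) * (z - 1))
      - t * ((1 / 2 : ℂ) * (z + 1) * ((1 / 2 : ℂ) * (z - 1)))‖ ≤ 2 * t ^ 2 := by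
  obtain ⟨x, hx⟩ := exists_cayley_eq_I_mul hz
  by_cases h1 : z = 1
  · subst h1; simp; positivity
  have h2 : z - 1 ≠ 0 := sub_ne_zero.2 h1
  have hp : z + 1 = Complex.I * x * (z - 1) := by rw [← hx]; field_simp
  have e : (1 / 2 : ℂ) * (z - 1) * cayleyExp t z - (1 / 2 : ℂ) * (z - 1) * ((1 / 2 : ℂ) * (z - 1))
      - t * ((1 / 2 : ℂ) * (z + 1) * ((1 / 2 : ℂ) * (z - 1))) =
      ((1 / 2 : ℂ) * (z - 1)) ^ 2 *
        (Complex.exp (Complex.I * (t * x : ℝ)) - 1 - Complex.I * (t * x : ℝ)) := by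
    have hexp : Complex.I * ((t * x : ℝ) : ℂ) = t * ((z + 1) / (z - 1)) := by
      rw [hx]; push_cast; ring
    rw [cayleyExp, hexp, hx, hp]
    ring
  rw [e, norm_mul, norm_pow]
  have h3 := norm_half_mul_sub_one_mul_le hz hx
  calc _ ≤ ‖(1 / 2 : ℂ) * (z - 1)‖ ^ 2 * (2 * (t * x) ^ 2) := by
        gcongr; exact norm_exp_I_mul_sub_one_sub_le _
    _ = (‖(1 / 2 : ℂ) * (z - 1)‖ * |x|) ^ 2 * (2 * t ^ 2) := by
        rw [mul_pow, mul_pow, sq_abs]; ring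
    _ ≤ 1 ^ 2 * (2 * t ^ 2) := by gcongr
    _ = _ := by ring

variable [CompleteSpace H] {L : H →ₗ.[ℂ] H} {B V : H →L[ℂ] H}

theorem IsCayley.denseRange (h : IsCayley L B V) (hL : IsSkewHermitian L) : DenseRange B := by
  refine hL.1.mono fun x hx => ?_
  exact ⟨_, h.inv _ _ (graph_apply hx)⟩

theorem IsCayley.continuousOn_exp (h : IsCayley L B V) (t : ℝ) :
    ContinuousOn (cayleyExp t) (spectrum ℂ V) :=
  continuousOn_cayleyExp t fun _ hz => h.norm_eq_one hz

theorem IsCayley.cfc_exp_zero (h : IsCayley L B V) : cfc (cayleyExp 0) V = B := by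
  rw [← h.cfc_eq]
  refine cfc_congr fun z _ => ?_
  simp [cayleyExp]

theorem IsCayley.cfc_exp_mul (h : IsCayley L B V) (s t : ℝ) :
    cfc (cayleyExp s) V * cfc (cayleyExp t) V = cfc (cayleyExp (s + t)) V * B := by
  rw [← h.cfc_eq, ← cfc_mul _ _ V (h.continuousOn_exp s) (h.continuousOn_exp t),
    ← cfc_mul _ _ V (h.continuousOn_exp _) (by fun_prop)]
  refine cfc_congr fun z _ => ?_
  simp only [cayleyExp]
  rw [Complex.ofReal_add, add_mul, Complex.exp_add]
  ring

theorem IsCayley.cfc_exp_comm (h : IsCayley L B V) (t : ℝ) :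
    cfc (cayleyExp t) V * B = B * cfc (cayleyExp t) V := by
  rw [← h.cfc_eq]
  exact cfc_commute_cfc _ _ V

/-- The symbols of the two operators have the same modulus on the circle. This is what lets `B y ↦ e
^ (t L) B y` extend from the range of `B`. -/
theorem IsCayley.norm_cfc_exp_apply (h : IsCayley L B V) (t : ℝ) (y : H) :
    ‖cfc (cayleyExp t) V y‖ = ‖B y‖ := by
  have key : star (cfc (cayleyExp t) V) * cfc (cayleyExp t) V = star B * B := by
    have hc := h.continuousOn_exp t
    rw [← h.cfc_eq, ← cfc_star, ← cfc_star, ← cfc_mul _ _ V hc.star hc,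
      ← cfc_mul _ _ V (by fun_prop) (by fun_prop)]
    refine cfc_congr fun z hz => ?_
    have h1 := norm_exp_cayley (h.norm_eq_one hz) t
    simp only [cayleyExp, Complex.star_def]
    rw [mul_comm, Complex.mul_conj, mul_comm, mul_comm ((starRingEnd ℂ) _), Complex.mul_conj]
    simp only [Complex.normSq_eq_norm_sq, norm_mul, h1, one_mul]
  have h2 : ∀ A : H →L[ℂ] H, ‖A y‖ ^ 2 = RCLike.re ⟪y, (star A * A) y⟫_ℂ := fun A => by
    rw [ContinuousLinearMap.star_eq_adjoint]
    exact ContinuousLinearMap.apply_norm_sq_eq_inner_adjoint_right A y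
  rw [← sq_eq_sq₀ (norm_nonneg _) (norm_nonneg _), h2, h2, key]

theorem IsCayley.norm_cfc_exp_sub_le (h : IsCayley L B V) (s t : ℝ) :
    ‖cfc (cayleyExp t) V - cfc (cayleyExp s) V‖ ≤ |t - s| := by
  rw [← cfc_sub _ _ _ (h.continuousOn_exp t) (h.continuousOn_exp s)]
  exact norm_cfc_le (abs_nonneg _) fun z hz => norm_cayleyExp_sub_le (h.norm_eq_one hz) s t

theorem IsCayley.norm_cfc_exp_taylor_le (h : IsCayley L B V) (t : ℝ) :
    ‖B * cfc (cayleyExp t) V - B * B - (t : ℂ) • ((1 + B) * B)‖ ≤ 2 * t ^ 2 := by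
  have hN := h.isStarNormal
  have hc := h.continuousOn_exp t
  have hB1 : cfc (fun z : ℂ => (1 / 2 : ℂ) * (z + 1)) V = 1 + B := by
    rw [← cfc_const_one ℂ V, ← h.cfc_eq, ← cfc_add _ _ _ (by fun_prop) (by fun_prop)]
    exact cfc_congr fun z _ => by ring
  rw [← hB1, ← h.cfc_eq, ← cfc_mul _ _ V (by fun_prop) hc,
    ← cfc_mul _ _ V (by fun_prop) (by fun_prop), ← cfc_mul _ _ V (by fun_prop) (by fun_prop),
    ← cfc_const_mul _ _ _ (by fun_prop), ← cfc_sub _ _ _ (by fun_prop) (by fun_prop),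
    ← cfc_sub _ _ _ (by fun_prop) (by fun_prop)]
  exact norm_cfc_le (by positivity) fun z hz => norm_cayleyExp_taylor_le (h.norm_eq_one hz) t

end ExpSymbol

/-! ### The unitary group: existence, generator, uniqueness -/

section Group

open Filter Topology

theorem IsGroupGeneratedBy.mem_graph {L : H →ₗ.[ℂ] H} {U : ℝ → H →L[ℂ] H} (hU : IsGroupGeneratedBy L U) {x y : H}
    (hxy : (x, y) ∈ L.graph) (t : ℝ) : (U t x, U t y) ∈ L.graph := by
  rw [hU.generator]
  have e : (fun s : ℝ => U s (U t x)) = fun s => U t (U s x) := by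
    ext s
    change (U s * U t) x = (U t * U s) x
    rw [← hU.add, ← hU.add, add_comm]
  rw [e]
  exact ((U t).restrictScalars ℝ).hasFDerivAt.comp_hasDerivAt (0 : ℝ) ((hU.generator x y).1 hxy)

theorem IsGroupGeneratedBy.hasDerivAt {L : H →ₗ.[ℂ] H} {U : ℝ → H →L[ℂ] H} (hU : IsGroupGeneratedBy L U)
    {x y : H} (hxy : (x, y) ∈ L.graph) (t : ℝ) : HasDerivAt (fun s => U s x) (U t y) t := by
  have e : (fun s : ℝ => U s x) = fun s => U t (U (s - t) x) := by
    ext s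
    change U s x = (U t * U (s - t)) x
    rw [← hU.add, add_sub_cancel]
  rw [e]
  have h0 : HasDerivAt (fun s : ℝ => U s x) y (t - t) := by
    rw [sub_self]; exact (hU.generator x y).1 hxy
  exact ((U t).restrictScalars ℝ).hasFDerivAt.comp_hasDerivAt t (h0.comp_sub_const t t)

variable [CompleteSpace H] {L : H →ₗ.[ℂ] H} {B V : H →L[ℂ] H}

/-- The group generated by `L`, as the extension by density of
`(L - 1)⁻¹ y ↦ e ^ (t L) (L - 1)⁻¹ y`. -/
def cayleyGroup (B V : H →L[ℂ] H) (t : ℝ) : H →L[ℂ] H :=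
  (cfc (cayleyExp t) V).toLinearMap.extendOfNorm B.toLinearMap

theorem IsCayley.group_apply (h : IsCayley L B V) (hL : IsSkewHermitian L) (t : ℝ) (y : H) :
    cayleyGroup B V t (B y) = cfc (cayleyExp t) V y :=
  LinearMap.extendOfNorm_eq (e := B.toLinearMap) (h.denseRange hL)
    ⟨1, fun x => by simp [h.norm_cfc_exp_apply]⟩ y

theorem IsCayley.norm_group_le (h : IsCayley L B V) (hL : IsSkewHermitian L) (t : ℝ) :
    ‖cayleyGroup B V t‖ ≤ 1 :=
  LinearMap.opNorm_extendOfNorm_le (e := B.toLinearMap) (h.denseRange hL) zero_le_one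
    fun x => by simp [h.norm_cfc_exp_apply]

theorem IsCayley.group_zero (h : IsCayley L B V) (hL : IsSkewHermitian L) :
    cayleyGroup B V 0 = 1 := by
  refine DFunLike.coe_injective <| (h.denseRange hL).equalizer (by fun_prop) (by fun_prop) ?_
  ext y
  simp [h.group_apply hL, h.cfc_exp_zero]

theorem IsCayley.group_add (h : IsCayley L B V) (hL : IsSkewHermitian L) (s t : ℝ) :
    cayleyGroup B V (s + t) = cayleyGroup B V s * cayleyGroup B V t := by
  -- The product of two regularized symbols carries two factors `B`, so the identity is tested on
  -- the range of `B ∘ B`, still dense.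
  refine DFunLike.coe_injective <| ((h.denseRange hL).comp (h.denseRange hL)
    B.continuous).equalizer (by fun_prop) (by fun_prop) ?_
  ext y
  have h1 : cfc (cayleyExp t) V (B y) = B (cfc (cayleyExp t) V y) :=
    DFunLike.congr_fun (h.cfc_exp_comm t) y
  have h2 : cfc (cayleyExp s) V (cfc (cayleyExp t) V y) = cfc (cayleyExp (s + t)) V (B y) :=
    DFunLike.congr_fun (h.cfc_exp_mul s t) y
  change cayleyGroup B V (s + t) (B (B y)) = cayleyGroup B V s (cayleyGroup B V t (B (B y)))
  rw [h.group_apply hL, h.group_apply hL, h1, h.group_apply hL, h2]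

theorem IsCayley.norm_group_apply (h : IsCayley L B V) (hL : IsSkewHermitian L) (t : ℝ) (x : H) :
    ‖cayleyGroup B V t x‖ = ‖x‖ := by
  have hle : ∀ t x, ‖cayleyGroup B V t x‖ ≤ ‖x‖ := fun t x => by
    simpa using (cayleyGroup B V t).le_of_opNorm_le (h.norm_group_le hL t) x
  refine le_antisymm (hle t x) ?_
  have h1 := hle (-t) (cayleyGroup B V t x)
  have h2 : cayleyGroup B V (-t) (cayleyGroup B V t x) = x := by
    have := DFunLike.congr_fun (h.group_add hL (-t) t) x
    rw [neg_add_cancel, h.group_zero hL] at this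
    exact this.symm
  rwa [h2] at h1

theorem IsCayley.inner_group_apply (h : IsCayley L B V) (hL : IsSkewHermitian L) (t : ℝ)
    (x y : H) : ⟪cayleyGroup B V t x, cayleyGroup B V t y⟫_ℂ = ⟪x, y⟫_ℂ :=
  LinearIsometry.inner_map_map
    (⟨(cayleyGroup B V t).toLinearMap, h.norm_group_apply hL t⟩ : H →ₗᵢ[ℂ] H) x y

theorem IsCayley.continuous_group (h : IsCayley L B V) (hL : IsSkewHermitian L) (x : H) :
    Continuous fun t => cayleyGroup B V t x := by
  rw [continuous_iff_continuousAt]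
  intro s
  refine tendsto_apply_of_denseRange (h.denseRange hL) (h.norm_group_le hL) (fun y => ?_) x
  simp only [h.group_apply hL]
  rw [tendsto_iff_norm_sub_tendsto_zero]
  have h0 : Tendsto (fun t : ℝ => |t - s| * ‖y‖) (𝓝 s) (𝓝 (|s - s| * ‖y‖)) :=
    (by fun_prop : Continuous fun t : ℝ => |t - s| * ‖y‖).tendsto s
  rw [sub_self, abs_zero, zero_mul] at h0
  refine squeeze_zero (fun _ => norm_nonneg _) (fun t => ?_) h0
  rw [← sub_apply]
  exact ContinuousLinearMap.le_of_opNorm_le _ (h.norm_cfc_exp_sub_le s t) y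

theorem IsCayley.hasDerivAt_group (h : IsCayley L B V) (hL : IsSkewHermitian L) {x y : H}
    (hxy : (x, y) ∈ L.graph) : HasDerivAt (fun t : ℝ => cayleyGroup B V t x) y 0 := by
  rw [hasDerivAt_iff_tendsto_slope_zero]
  set f := y - x with hf
  have hx : B f = x := h.inv x y hxy
  have hy : (1 + B) f = y := by
    change f + B f = y
    rw [hx, hf, sub_add_cancel]
  have e : ∀ t : ℝ, t⁻¹ • (cayleyGroup B V (0 + t) x - cayleyGroup B V 0 x) =
      ((t : ℂ)⁻¹ • (cfc (cayleyExp t) V - B)) f := fun t => by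
    rw [zero_add, h.group_zero hL, ← hx, h.group_apply hL]
    simp [← Complex.ofReal_inv]
  simp only [e]
  rw [← hy]
  -- The difference quotients are bounded by 1 by the Lipschitz estimate (also at `t = 0`, where
  -- `0⁻¹ = 0`), so convergence is needed only on the range of `B`, where the Taylor estimate
  -- applies.
  refine tendsto_apply_of_denseRange (h.denseRange hL) (C := 1) (fun t => ?_) (fun z => ?_) f
  · rw [norm_smul, norm_inv, Complex.norm_real, Real.norm_eq_abs]
    have h1 := h.norm_cfc_exp_sub_le 0 t
    rw [h.cfc_exp_zero, sub_zero] at h1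
    calc _ ≤ |t|⁻¹ * |t| := by gcongr
      _ ≤ 1 := inv_mul_le_one
  · rw [tendsto_iff_norm_sub_tendsto_zero]
    have h0 : Tendsto (fun t : ℝ => 2 * |t| * ‖z‖) (𝓝[≠] 0) (𝓝 (2 * |0| * ‖z‖)) :=
      ((by fun_prop : Continuous fun t : ℝ => 2 * |t| * ‖z‖).tendsto 0).mono_left
        nhdsWithin_le_nhds
    rw [abs_zero, mul_zero, zero_mul] at h0
    refine squeeze_zero' (Eventually.of_forall fun _ => norm_nonneg _) ?_ h0
    filter_upwards [self_mem_nhdsWithin] with t ht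
    have ht' : (t : ℂ) ≠ 0 := by exact_mod_cast ht
    have e2 : ((t : ℂ)⁻¹ • (cfc (cayleyExp t) V - B)) (B z) - (1 + B) (B z) =
        (t : ℂ)⁻¹ • (B * cfc (cayleyExp t) V - B * B - (t : ℂ) • ((1 + B) * B)) z := by
      rw [← h.cfc_exp_comm t]
      simp only [smul_apply, sub_apply, smul_sub,
        smul_smul, inv_mul_cancel₀ ht', one_smul]
      rfl
    rw [e2, norm_smul, norm_inv, Complex.norm_real, Real.norm_eq_abs]
    have h2 := ContinuousLinearMap.le_of_opNorm_le _ (h.norm_cfc_exp_taylor_le t) z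
    have h3 : 0 < |t| := abs_pos.2 ht
    calc _ ≤ |t|⁻¹ * (2 * t ^ 2 * ‖z‖) := by gcongr
      _ = 2 * |t| * ‖z‖ := by
        rw [← sq_abs]
        field_simp

theorem IsCayley.isGroupGeneratedBy (h : IsCayley L B V) (hL : IsSkewHermitian L) :
    IsGroupGeneratedBy L (cayleyGroup B V) where
  zero := h.group_zero hL
  add := h.group_add hL
  continuous := h.continuous_group hL
  generator x y := by
    refine ⟨h.hasDerivAt_group hL, fun hx => hL.mem_graph_iff.2 fun u v huv => ?_⟩
    -- Only the converse is left: `⟪U t x, U t u⟫` is constant, and its zero derivative at 0 is the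
    -- annihilator condition characterizing the graph.
    have h1 := hx.inner ℂ (h.hasDerivAt_group hL huv)
    simp only [h.inner_group_apply hL, h.group_zero hL] at h1
    rw [add_comm]
    exact h1.unique (hasDerivAt_const _ _)

theorem IsSkewHermitian.norm_eq_of_hasDerivAt (hL : IsSkewHermitian L) {w w' : ℝ → H}
    (hg : ∀ t, (w t, w' t) ∈ L.graph) (hw : ∀ t, HasDerivAt w (w' t) t) (t : ℝ) :
    ‖w t‖ = ‖w 0‖ := by
  have hd : ∀ t, HasDerivAt (fun s => ⟪w s, w s⟫_ℂ) 0 t := fun t => by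
    have := (hw t).inner ℂ (hw t)
    rwa [add_comm, hL.mem_graph_iff.1 (hg t) _ _ (hg t)] at this
  have h1 := is_const_of_deriv_eq_zero (fun t => (hd t).differentiableAt)
    (fun t => (hd t).deriv) t 0
  simp only [inner_self_eq_norm_sq_to_K] at h1
  have h2 : ‖w t‖ ^ 2 = ‖w 0‖ ^ 2 := by exact_mod_cast h1
  exact (sq_eq_sq₀ (norm_nonneg _) (norm_nonneg _)).1 h2

/-- Uniqueness for `w' = L w`: the difference of two solutions has constant norm and vanishes at 0.
-/
theorem IsGroupGeneratedBy.apply_eq (hL : IsSkewHermitian L) {U : ℝ → H →L[ℂ] H}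
    (hU : IsGroupGeneratedBy L U) {w w' : ℝ → H} (hg : ∀ t, (w t, w' t) ∈ L.graph)
    (hw : ∀ t, HasDerivAt w (w' t) t) (t : ℝ) : U t (w 0) = w t := by
  have h1 := hL.norm_eq_of_hasDerivAt (w := fun s => U s (w 0) - w s)
    (w' := fun s => U s (w' 0) - w' s)
    (fun s => L.graph.sub_mem (hU.mem_graph (hg 0) s) (hg s))
    (fun s => (hU.hasDerivAt (hg 0) s).sub (hw s)) t
  rw [hU.zero] at h1
  simpa [sub_eq_zero] using h1

theorem IsGroupGeneratedBy.unique (hL : IsSkewHermitian L) {U U' : ℝ → H →L[ℂ] H}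
    (hU : IsGroupGeneratedBy L U) (hU' : IsGroupGeneratedBy L U') : U = U' := by
  ext1 t
  refine DFunLike.coe_injective <| Continuous.ext_on hL.1 (by fun_prop) (by fun_prop) ?_
  intro x hx
  have h1 := hU.apply_eq hL (hU'.mem_graph (graph_apply hx)) (hU'.hasDerivAt (graph_apply hx)) t
  rwa [hU'.zero] at h1

theorem IsSkewHermitian.isGroupGeneratedBy_opExp (hL : IsSkewHermitian L) :
    IsGroupGeneratedBy L (opExp L) := by
  obtain ⟨B, V, h⟩ := hL.exists_isCayley
  have hex : ∃ U : ℝ → H →L[ℂ] H, IsGroupGeneratedBy L U := ⟨_, h.isGroupGeneratedBy hL⟩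
  rw [opExp, dif_pos hex]
  exact hex.choose_spec

theorem IsSkewHermitian.norm_opExp_apply (hL : IsSkewHermitian L) (t : ℝ) (x : H) :
    ‖opExp L t x‖ = ‖x‖ := by
  obtain ⟨B, V, h⟩ := hL.exists_isCayley
  rw [hL.isGroupGeneratedBy_opExp.unique hL (h.isGroupGeneratedBy hL)]
  exact h.norm_group_apply hL t x

end Group

/-! ### Invariant subspaces where the operator is bounded, and the error bound -/

section Restriction

open Filter Topology

theorem graph_unique {L : H →ₗ.[ℂ] H} {x y y' : H} (h : (x, y) ∈ L.graph)
    (h' : (x, y') ∈ L.graph) : y = y' := by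
  obtain ⟨_, rfl⟩ := mem_domain_of_graph h
  obtain ⟨_, rfl⟩ := mem_domain_of_graph h'
  rfl

/-- `K` is contained in the domain of `L`, which maps it into itself with norm at most `Λ`. -/
def IsBoundedOn (L : H →ₗ.[ℂ] H) (K : Submodule ℂ H) (Λ : ℝ) : Prop :=
  ∀ v ∈ K, ∃ w ∈ K, (v, w) ∈ L.graph ∧ ‖w‖ ≤ Λ * ‖v‖

theorem IsBoundedOn.exists_clm {L : H →ₗ.[ℂ] H} {K : Submodule ℂ H} {Λ : ℝ}
    (hK : IsBoundedOn L K Λ) :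
    ∃ S : K →L[ℂ] K, ∀ v : K, ((v : H), (S v : H)) ∈ L.graph ∧ ‖S v‖ ≤ Λ * ‖v‖ := by
  choose s hsK hsg hsn using hK
  let Sl : K →ₗ[ℂ] K :=
    { toFun := fun v => ⟨s v v.2, hsK v v.2⟩
      map_add' := fun u v => Subtype.ext <|
        graph_unique (hsg _ (u + v).2) (L.graph.add_mem (hsg u u.2) (hsg v v.2))
      map_smul' := fun c v => Subtype.ext <|
        graph_unique (hsg _ (c • v).2) (L.graph.smul_mem c (hsg v v.2)) }
  exact ⟨Sl.mkContinuous Λ fun v => hsn v v.2, fun v => ⟨hsg v v.2, hsn v v.2⟩⟩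

/-- The bound turns Cauchy sequences in `K` into Cauchy sequences of images, and the graph is
closed. -/
theorem IsBoundedOn.topologicalClosure [CompleteSpace H] {L : H →ₗ.[ℂ] H}
    (hL : IsSkewHermitian L) {K : Submodule ℂ H} {Λ : ℝ} (hK : IsBoundedOn L K Λ) :
    IsBoundedOn L K.topologicalClosure Λ := by
  intro v hv
  obtain ⟨u, huK, huv⟩ := mem_closure_iff_seq_limit.1 (show v ∈ closure (K : Set H) from hv)
  choose w hwK hwg hwn using fun n => hK (u n) (huK n)
  have hdiff : ∀ m n, dist (w m) (w n) ≤ Λ * dist (u m) (u n) := fun m n => by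
    obtain ⟨w', _, hg, hn⟩ := hK _ (K.sub_mem (huK m) (huK n))
    rw [dist_eq_norm, dist_eq_norm, graph_unique (L.graph.sub_mem (hwg m) (hwg n)) hg]
    exact hn
  have hc : CauchySeq w := by
    rw [cauchySeq_iff_tendsto_dist_atTop_0]
    have h0 := (cauchySeq_iff_tendsto_dist_atTop_0.1 huv.cauchySeq).const_mul Λ
    rw [mul_zero] at h0
    exact squeeze_zero (fun _ => dist_nonneg) (fun p => hdiff p.1 p.2) h0
  obtain ⟨y, hy⟩ := cauchySeq_tendsto_of_complete hc
  refine ⟨y, mem_closure_of_tendsto hy (Eventually.of_forall hwK), ?_, ?_⟩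
  · exact hL.isClosed_graph.mem_of_tendsto (huv.prodMk_nhds hy) (Eventually.of_forall hwg)
  · exact le_of_tendsto_of_tendsto' hy.norm (huv.norm.const_mul Λ) hwn

theorem re_eq_zero_of_mem_spectrum {A : Type*} [CStarAlgebra A] {a : A} (ha : star a = -a)
    {z : ℂ} (hz : z ∈ spectrum ℂ a) : z.re = 0 := by
  have hsa : IsSelfAdjoint (Complex.I • a) := by
    rw [isSelfAdjoint_iff, star_smul, ha]
    simp
  have h1 : Complex.I * z ∈ spectrum ℂ (Complex.I • a) :=
    (spectrum.smul_mem_smul_iff (r := Units.mk0 Complex.I Complex.I_ne_zero)).2 hz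
  have h2 := congrArg Complex.im (hsa.mem_spectrum_eq_re h1)
  simpa using h2

section CStarAlgebra

variable {A : Type*} [CStarAlgebra A] {a : A}

theorem isStarNormal_of_star_eq_neg (ha : star a = -a) : IsStarNormal a :=
  ⟨by rw [ha]; exact (Commute.refl a).neg_left⟩

theorem mul_sub_ne_zero_of_mem_spectrum (ha : star a = -a) (τ : ℝ) {c : ℂ} (hc : c.re ≠ 0)
    {z : ℂ} (hz : z ∈ spectrum ℂ a) : (τ : ℂ) * z - c ≠ 0 := by
  intro h
  apply hc
  rw [← sub_eq_zero.1 h]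
  simp [re_eq_zero_of_mem_spectrum ha hz]

theorem continuousOn_inv_mul_sub (ha : star a = -a) (τ : ℝ) {c : ℂ} (hc : c.re ≠ 0) :
    ContinuousOn (fun z : ℂ => ((τ : ℂ) * z - c)⁻¹) (spectrum ℂ a) :=
  ContinuousOn.inv₀ (by fun_prop) fun _ hz => mul_sub_ne_zero_of_mem_spectrum ha τ hc hz

theorem smul_sub_mul_cfc_inv (ha : star a = -a) (τ : ℝ) {c : ℂ} (hc : c.re ≠ 0) :
    ((τ : ℂ) • a - c • 1) * cfc (fun z : ℂ => ((τ : ℂ) * z - c)⁻¹) a = 1 := by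
  have hN := isStarNormal_of_star_eq_neg ha
  have e1 : (τ : ℂ) • a - c • 1 = cfc (fun z : ℂ => (τ : ℂ) * z - c * 1) a := by
    rw [cfc_sub _ _ _ (by fun_prop) (by fun_prop), cfc_const_mul _ _ _ (by fun_prop),
      cfc_const_mul _ _ _ (by fun_prop), cfc_id' ℂ a, cfc_const_one ℂ a]
  rw [e1, ← cfc_mul _ _ a (by fun_prop) (continuousOn_inv_mul_sub ha τ hc), ← cfc_const_one ℂ a]
  refine cfc_congr fun z hz => ?_
  simp only [mul_one]
  exact mul_inv_cancel₀ (mul_sub_ne_zero_of_mem_spectrum ha τ hc hz)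

theorem exp_smul_eq_cfc (ha : star a = -a) (τ : ℝ) :
    NormedSpace.exp (τ • a) = cfc (fun z : ℂ => Complex.exp ((τ : ℂ) * z)) a := by
  have hN := isStarNormal_of_star_eq_neg ha
  have hN' : IsStarNormal (τ • a) :=
    isStarNormal_of_star_eq_neg (by rw [star_smul, ha, star_trivial, smul_neg])
  rw [cfc_comp_const_mul (τ : ℂ) Complex.exp a, Complex.coe_smul]
  exact (CFC.complex_exp_eq_normedSpace_exp hN').symm

/-- The spectrum of `a` lies in `i [-Λ, Λ]`, so the scalar hypothesis bounds the symbol of the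
difference there. -/
theorem norm_exp_sub_sum_le (ha : star a = -a) {τ : ℝ} (hτ : 0 < τ) {M : ℕ}
    {b α : ℤ → ℂ} (hα : ∀ m ∈ Finset.Icc (-(M : ℤ)) M, (α m).re ≠ 0) {Λ δ : ℝ} (hδ0 : 0 ≤ δ)
    (hΛ : ∀ z ∈ spectrum ℂ a, ‖z‖ ≤ Λ)
    (hδ : ∀ x ∈ Set.Icc (-(τ * Λ)) (τ * Λ),
      ‖Complex.exp (Complex.I * x) - ratFun M b α (Complex.I * x)‖ ≤ δ) :
    ‖NormedSpace.exp (τ • a) - ∑ m ∈ Finset.Icc (-(M : ℤ)) M,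
      b m • cfc (fun z : ℂ => ((τ : ℂ) * z - α m)⁻¹) a‖ ≤ δ := by
  have hN := isStarNormal_of_star_eq_neg ha
  have hc : ∀ m ∈ Finset.Icc (-(M : ℤ)) M,
      ContinuousOn (fun z : ℂ => b m * ((τ : ℂ) * z - α m)⁻¹) (spectrum ℂ a) := fun m hm =>
    continuousOn_const.mul (continuousOn_inv_mul_sub ha τ (hα m hm))
  set r : ℂ → ℂ := ∑ m ∈ Finset.Icc (-(M : ℤ)) M, fun z => b m * ((τ : ℂ) * z - α m)⁻¹ with hr
  have hrc : ContinuousOn r (spectrum ℂ a) := by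
    have := continuousOn_finsetSum (Finset.Icc (-(M : ℤ)) M) hc
    refine this.congr fun z _ => ?_
    rw [hr, Finset.sum_apply]
  have hsum : ∑ m ∈ Finset.Icc (-(M : ℤ)) M, b m • cfc (fun z : ℂ => ((τ : ℂ) * z - α m)⁻¹) a =
      cfc r a := by
    rw [hr, cfc_sum _ _ _ hc]
    exact Finset.sum_congr rfl fun m hm =>
      (cfc_const_mul _ _ _ (continuousOn_inv_mul_sub ha τ (hα m hm))).symm
  rw [hsum, exp_smul_eq_cfc ha, ← cfc_sub _ _ _ (by fun_prop) hrc]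
  refine norm_cfc_le hδ0 fun z hz => ?_
  have h0 : z = Complex.I * z.im := by
    apply Complex.ext <;> simp [re_eq_zero_of_mem_spectrum ha hz]
  have hy := abs_le.1 ((Complex.abs_im_le_norm z).trans (hΛ z hz))
  have hmem : τ * z.im ∈ Set.Icc (-(τ * Λ)) (τ * Λ) := by
    constructor <;> nlinarith
  have := hδ _ hmem
  have e : Complex.I * ((τ * z.im : ℝ) : ℂ) = τ * z := by
    conv_rhs => rw [h0]
    push_cast; ring
  rw [e] at this
  rw [hr, Finset.sum_apply]
  simpa only [ratFun, div_eq_mul_inv] using this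

end CStarAlgebra

section Restriction

variable {F : Type*} [NormedAddCommGroup F] [InnerProductSpace ℂ F] [CompleteSpace F]
  [CompleteSpace H] {L : H →ₗ.[ℂ] H} {ι : F →ₗᵢ[ℂ] H} {S : F →L[ℂ] F}

theorem IsSkewHermitian.star_restriction (hL : IsSkewHermitian L)
    (hS : ∀ v, (ι v, ι (S v)) ∈ L.graph) : star S = -S := by
  rw [ContinuousLinearMap.star_eq_adjoint, eq_comm, ContinuousLinearMap.eq_adjoint_iff]
  intro x y
  have := hL.mem_graph_iff.1 (hS x) _ _ (hS y)
  rw [ι.inner_map_map, ι.inner_map_map] at this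
  rw [neg_apply, inner_neg_left]
  linear_combination -this

/-- Both sides solve `w' = L w` with the same initial value. -/
theorem IsSkewHermitian.opExp_restriction (hL : IsSkewHermitian L)
    (hS : ∀ v, (ι v, ι (S v)) ∈ L.graph) (τ : ℝ) (u : F) :
    opExp L τ (ι u) = ι (NormedSpace.exp (τ • S) u) := by
  let ev : (F →L[ℂ] F) →L[ℝ] H :=
    (ι.toContinuousLinearMap.comp (ContinuousLinearMap.apply ℂ F u)).restrictScalars ℝ
  have hd : ∀ t : ℝ, HasDerivAt (fun t : ℝ => ι (NormedSpace.exp (t • S) u))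
      (ι (S (NormedSpace.exp (t • S) u))) t := fun t =>
    ev.hasFDerivAt.comp_hasDerivAt t (hasDerivAt_exp_smul_const' (𝕂 := ℝ) S t)
  have h1 := hL.isGroupGeneratedBy_opExp.apply_eq hL (fun t => hS _) hd τ
  rw [← h1, zero_smul, NormedSpace.exp_zero]
  rfl

theorem IsSkewHermitian.shiftInverse_restriction (hL : IsSkewHermitian L)
    (hS : ∀ v, (ι v, ι (S v)) ∈ L.graph) {τ : ℝ} (hτ : τ ≠ 0) {c : ℂ} (hc : c.re ≠ 0)
    (u : F) : shiftInverse ((τ : ℂ) • L) c (ι u) =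
      ι (cfc (fun z : ℂ => ((τ : ℂ) * z - c)⁻¹) S u) := by
  have hid := smul_sub_mul_cfc_inv (hL.star_restriction hS) τ hc
  generalize cfc (fun z : ℂ => ((τ : ℂ) * z - c)⁻¹) S = G at *
  have h1 := (hL.isShiftInverse hτ hc).apply_eq (mem_graph_smul (c := (τ : ℂ)) (hS (G u)))
  have h2 : (τ : ℂ) • S (G u) - c • G u = u := DFunLike.congr_fun hid u
  rwa [← map_smul ι, ← map_smul ι, ← map_sub ι, h2] at h1

theorem IsSkewHermitian.opExp_sub_ratOp_restriction (hL : IsSkewHermitian L)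
    (hS : ∀ v, (ι v, ι (S v)) ∈ L.graph) {τ : ℝ} (hτ : τ ≠ 0) {M : ℕ}
    {b α : ℤ → ℂ} (hα : ∀ m ∈ Finset.Icc (-(M : ℤ)) M, (α m).re ≠ 0) (v : F) :
    opExp L τ (ι v) - ratOp M b α ((τ : ℂ) • L) (ι v) =
      ι ((NormedSpace.exp (τ • S) - ∑ m ∈ Finset.Icc (-(M : ℤ)) M,
        b m • cfc (fun z : ℂ => ((τ : ℂ) * z - α m)⁻¹) S) v) := by
  have hr : ratOp M b α ((τ : ℂ) • L) (ι v) = ι ((∑ m ∈ Finset.Icc (-(M : ℤ)) M,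
      b m • cfc (fun z : ℂ => ((τ : ℂ) * z - α m)⁻¹) S) v) := by
    rw [ratOp, sum_apply, sum_apply, map_sum]
    refine Finset.sum_congr rfl fun m hm => ?_
    rw [smul_apply, hL.shiftInverse_restriction hS hτ (hα m hm), smul_apply, map_smul]
  rw [hL.opExp_restriction hS, hr, sub_apply, map_sub]

theorem IsSkewHermitian.norm_opExp_sub_ratOp_restriction_le (hL : IsSkewHermitian L)
    (hS : ∀ v, (ι v, ι (S v)) ∈ L.graph) {τ : ℝ} (hτ : 0 < τ) {M : ℕ}
    {b α : ℤ → ℂ} (hα : ∀ m ∈ Finset.Icc (-(M : ℤ)) M, (α m).re ≠ 0) {Λ δ : ℝ} (hΛ : ‖S‖ ≤ Λ)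
    (hδ : ∀ x ∈ Set.Icc (-(τ * Λ)) (τ * Λ),
      ‖Complex.exp (Complex.I * x) - ratFun M b α (Complex.I * x)‖ ≤ δ) (v : F) :
    ‖opExp L τ (ι v) - ratOp M b α ((τ : ℂ) • L) (ι v)‖ ≤ δ * ‖ι v‖ := by
  have hspec : ∀ z ∈ spectrum ℂ S, ‖z‖ ≤ Λ := fun z hz => by
    have h2 : ‖(1 : F →L[ℂ] F)‖ ≤ 1 := ContinuousLinearMap.norm_id_le
    calc ‖z‖ ≤ ‖S‖ * ‖(1 : F →L[ℂ] F)‖ := spectrum.norm_le_norm_mul_of_mem hz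
      _ ≤ ‖S‖ * 1 := by gcongr
      _ ≤ Λ := by rwa [mul_one]
  have hτΛ : 0 ≤ τ * Λ := mul_nonneg hτ.le ((norm_nonneg S).trans hΛ)
  have hδ0 : 0 ≤ δ := (norm_nonneg _).trans (hδ 0 ⟨by linarith, hτΛ⟩)
  rw [hL.opExp_sub_ratOp_restriction hS hτ.ne' hα, ι.norm_map, ι.norm_map]
  exact ContinuousLinearMap.le_of_opNorm_le _
    (norm_exp_sub_sum_le (hL.star_restriction hS) hτ hα hδ0 hspec hδ) _

end Restriction

theorem IsSkewHermitian.norm_opExp_sub_ratOp_le [CompleteSpace H] {L : H →ₗ.[ℂ] H}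
    (hL : IsSkewHermitian L) {τ : ℝ} (hτ : 0 < τ) {M : ℕ}
    {b α : ℤ → ℂ} (hα : ∀ m ∈ Finset.Icc (-(M : ℤ)) M, (α m).re ≠ 0) {Λ δ : ℝ} (hΛ : 0 ≤ Λ)
    (hδ : ∀ x ∈ Set.Icc (-(τ * Λ)) (τ * Λ),
      ‖Complex.exp (Complex.I * x) - ratFun M b α (Complex.I * x)‖ ≤ δ)
    {K : Submodule ℂ H} (hKc : IsClosed (K : Set H)) (hK : IsBoundedOn L K Λ) {v : H}
    (hv : v ∈ K) : ‖opExp L τ v - ratOp M b α ((τ : ℂ) • L) v‖ ≤ δ * ‖v‖ := by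
  have : CompleteSpace K := hKc.completeSpace_coe
  obtain ⟨S, hS⟩ := hK.exists_clm
  exact hL.norm_opExp_sub_ratOp_restriction_le (ι := K.subtypeₗᵢ) (fun v => (hS v).1) hτ hα
    (S.opNorm_le_bound hΛ fun x => (hS x).2) hδ ⟨v, hv⟩

theorem IsSkewHermitian.norm_opExp_sub_ratOp_le_projection [CompleteSpace H] {L : H →ₗ.[ℂ] H}
    (hL : IsSkewHermitian L) {τ : ℝ} (hτ : 0 < τ) {M : ℕ}
    {b α : ℤ → ℂ} (hα : ∀ m ∈ Finset.Icc (-(M : ℤ)) M, (α m).re ≠ 0)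
    (hR : ∀ x : ℝ, ‖ratFun M b α (Complex.I * x)‖ ≤ 1) {Λ δ : ℝ} (hΛ : 0 ≤ Λ)
    (hδ : ∀ x ∈ Set.Icc (-(τ * Λ)) (τ * Λ),
      ‖Complex.exp (Complex.I * x) - ratFun M b α (Complex.I * x)‖ ≤ δ)
    {K : Submodule ℂ H} (hKc : IsClosed (K : Set H)) (hK : IsBoundedOn L K Λ) {P : H →L[ℂ] H}
    (hPK : ∀ u, P u ∈ K) (hP : ∀ u, ‖P u‖ ≤ ‖u‖) (u : H) :
    ‖opExp L τ u - ratOp M b α ((τ : ℂ) • L) u‖ ≤ δ * ‖u‖ + 2 * ‖u - P u‖ := by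
  have hδ0 : 0 ≤ δ := (norm_nonneg _).trans (hδ 0 ⟨by simp; positivity, by positivity⟩)
  have h1 := hL.norm_opExp_sub_ratOp_le hτ hα hΛ hδ hKc hK (hPK u)
  have h2 := (ratOp M b α ((τ : ℂ) • L)).le_of_opNorm_le (hL.norm_ratOp_le hτ.ne' hα hR) (u - P u)
  have h3 := hL.norm_opExp_apply τ (u - P u)
  have e : opExp L τ u - ratOp M b α ((τ : ℂ) • L) u =
      (opExp L τ (P u) - ratOp M b α ((τ : ℂ) • L) (P u)) +
        (opExp L τ (u - P u) - ratOp M b α ((τ : ℂ) • L) (u - P u)) := by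
    simp only [map_sub]; abel
  rw [e]
  refine (norm_add_le _ _).trans (add_le_add (h1.trans (by gcongr; exact hP u)) ?_)
  refine (norm_sub_le _ _).trans ?_
  rw [h3]
  linarith

/-- The eigenvectors of `L` with eigenvalue `μ`, together with `0`. -/
def eigenspace (L : H →ₗ.[ℂ] H) (μ : ℂ) : Submodule ℂ H :=
  L.graph.comap (LinearMap.prod LinearMap.id (μ • LinearMap.id))

theorem mem_eigenspace {L : H →ₗ.[ℂ] H} {μ : ℂ} {v : H} :
    v ∈ eigenspace L μ ↔ (v, μ • v) ∈ L.graph :=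
  Iff.rfl

/-- Skewness makes an eigenvalue with nonzero eigenvector imaginary; paired with another eigenvector
it gives `(conj μ + ν) ⟪u, v⟫ = 0`. -/
theorem IsSkewHermitian.orthogonalFamily_eigenspace [CompleteSpace H] {L : H →ₗ.[ℂ] H}
    (hL : IsSkewHermitian L) (s : Set ℂ) :
    OrthogonalFamily ℂ (fun μ : s => eigenspace L μ) fun μ => (eigenspace L μ).subtypeₗᵢ := by
  intro μ ν hne u v
  change ⟪(u : H), (v : H)⟫_ℂ = 0
  have hu := mem_eigenspace.1 u.2
  have h1 := hL.mem_graph_iff.1 hu _ _ hu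
  have h2 := hL.mem_graph_iff.1 hu _ _ (mem_eigenspace.1 v.2)
  rw [inner_smul_left, inner_smul_right, ← add_mul] at h1 h2
  rcases mul_eq_zero.1 h1 with h | h
  · refine (mul_eq_zero.1 h2).resolve_left fun h' => hne (Subtype.ext ?_)
    linear_combination h - h'
  · rw [inner_self_eq_zero.1 h, inner_zero_left]

theorem IsSkewHermitian.isBoundedOn_iSup_eigenspace [CompleteSpace H] {L : H →ₗ.[ℂ] H}
    (hL : IsSkewHermitian L) {Λ : ℝ} (hΛ : 0 ≤ Λ) :
    IsBoundedOn L (⨆ μ : {μ : ℂ | ‖μ‖ ≤ Λ}, eigenspace L μ) Λ := by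
  intro v hv
  obtain ⟨f, hf, rfl⟩ := (Submodule.mem_iSup_iff_exists_finsupp _ _).1 hv
  have hO := hL.orthogonalFamily_eigenspace {μ : ℂ | ‖μ‖ ≤ Λ}
  have n1 := hO.norm_sum (fun μ => ⟨f μ, hf μ⟩) f.support
  have n2 := hO.norm_sum (fun μ => (μ : ℂ) • ⟨f μ, hf μ⟩) f.support
  refine ⟨∑ μ ∈ f.support, (μ : ℂ) • f μ, ?_, ?_, ?_⟩
  · exact Submodule.sum_mem _ fun μ _ => Submodule.smul_mem _ _
      (Submodule.mem_iSup_of_mem μ (hf μ))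
  · have := Submodule.sum_mem L.graph (t := f.support) (f := fun μ => (f μ, (μ : ℂ) • f μ))
      fun μ _ => mem_eigenspace.1 (hf μ)
    rwa [← prod_mk_sum] at this
  -- By Pythagoras both squared norms are sums over the eigenvalues, compared term by term.
  · rw [← sq_le_sq₀ (norm_nonneg _) (by positivity), mul_pow]
    refine (n2.trans_le ?_).trans (congrArg (Λ ^ 2 * ·) n1.symm).le
    rw [Finset.mul_sum]
    refine Finset.sum_le_sum fun μ _ => ?_
    rw [norm_smul, mul_pow]
    have := μ.2
    gcongr
    exact this

theorem IsSkewHermitian.isBoundedOn_eigenmodes [CompleteSpace H] {L : H →ₗ.[ℂ] H}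
    (hL : IsSkewHermitian L) {Λ : ℝ} (hΛ : 0 ≤ Λ) : IsBoundedOn L (eigenmodes L Λ) Λ := by
  have e : Submodule.span ℂ {v : H | ∃ h : v ∈ L.domain, ∃ μ : ℂ, ‖μ‖ ≤ Λ ∧ L ⟨v, h⟩ = μ • v} =
      ⨆ μ : {μ : ℂ | ‖μ‖ ≤ Λ}, eigenspace L μ := by
    refine le_antisymm (Submodule.span_le.2 ?_) (iSup_le fun μ v hv => ?_)
    · rintro v ⟨h, μ, hμ, he⟩
      exact Submodule.mem_iSup_of_mem ⟨μ, hμ⟩ (mem_eigenspace.2 (he ▸ graph_apply h))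
    · obtain ⟨h, he⟩ := mem_domain_of_graph (mem_eigenspace.1 hv)
      exact Submodule.subset_span ⟨h, μ, μ.2, he⟩
  rw [eigenmodes, e]
  exact (hL.isBoundedOn_iSup_eigenspace hΛ).topologicalClosure hL

theorem modeProj_mem [CompleteSpace H] (L : H →ₗ.[ℂ] H) (Λ : ℝ) (u : H) :
    modeProj L Λ u ∈ eigenmodes L Λ :=
  have : CompleteSpace (eigenmodes L Λ) :=
    (Submodule.isClosed_topologicalClosure _).completeSpace_coe
  Submodule.starProjection_apply_mem _ _

theorem norm_modeProj_apply_le [CompleteSpace H] (L : H →ₗ.[ℂ] H) (Λ : ℝ) (u : H) :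
    ‖modeProj L Λ u‖ ≤ ‖u‖ :=
  have : CompleteSpace (eigenmodes L Λ) :=
    (Submodule.isClosed_topologicalClosure _).completeSpace_coe
  Submodule.norm_starProjection_apply_le _ _

end Restriction

/-! ### Ranges of spectral projections -/

section Spectral

open Filter Topology MeasureTheory

theorem isFiniteMeasure_of_eq {F : Set ℝ → H →L[ℂ] H} {μ : Measure ℝ} {x : H}
    (hμ : ∀ S : Set ℝ, MeasurableSet S → μ S = ENNReal.ofReal (‖F S x‖ ^ 2)) :
    IsFiniteMeasure μ :=
  ⟨by rw [hμ _ MeasurableSet.univ]; exact ENNReal.ofReal_lt_top⟩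

variable [CompleteSpace H]

theorem _root_.IsStarProjection.inner_apply_left {P : H →L[ℂ] H} (hP : IsStarProjection P)
    (x y : H) : ⟪P x, y⟫_ℂ = ⟪x, P y⟫_ℂ := by
  conv_lhs => rw [← hP.isSelfAdjoint.star_eq, ContinuousLinearMap.star_eq_adjoint]
  exact ContinuousLinearMap.adjoint_inner_left P y x

theorem _root_.IsStarProjection.apply_apply {P : H →L[ℂ] H} (hP : IsStarProjection P) (x : H) :
    P (P x) = P x :=
  DFunLike.congr_fun hP.isIdempotentElem.eq x

theorem _root_.IsStarProjection.norm_apply_le {P : H →L[ℂ] H} (hP : IsStarProjection P) (x : H) :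
    ‖P x‖ ≤ ‖x‖ := by
  have h1 : ‖P x‖ ^ 2 ≤ ‖x‖ * ‖P x‖ := by
    have h2 : ⟪P x, P x⟫_ℂ = ⟪x, P x⟫_ℂ := by rw [hP.inner_apply_left, hP.apply_apply]
    have h3 : ‖⟪P x, P x⟫_ℂ‖ ≤ ‖x‖ * ‖P x‖ := h2 ▸ norm_inner_le_norm x (P x)
    rwa [inner_self_eq_norm_sq_to_K, norm_pow, RCLike.norm_ofReal, abs_norm] at h3
  by_contra! h
  nlinarith [norm_nonneg x]

variable {L : H →ₗ.[ℂ] H} {E : Set ℝ → H →L[ℂ] H}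

theorem IsSpectralMeasure.empty (hE : IsSpectralMeasure L E) : E ∅ = 0 := by
  ext x
  obtain ⟨μ, hμ, -⟩ := hE.represents x
  have := hμ ∅ MeasurableSet.empty
  rw [measure_empty, eq_comm, ENNReal.ofReal_eq_zero] at this
  simpa using le_antisymm this (sq_nonneg _)

theorem IsSpectralMeasure.apply_apply (hE : IsSpectralMeasure L E) {S T : Set ℝ}
    (hS : MeasurableSet S) (hT : MeasurableSet T) (x : H) : E S (E T x) = E (S ∩ T) x := by
  rw [hE.inter S T hS hT]
  rfl

theorem IsSpectralMeasure.comm (hE : IsSpectralMeasure L E) {S T : Set ℝ}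
    (hS : MeasurableSet S) (hT : MeasurableSet T) (x : H) : E S (E T x) = E T (E S x) := by
  rw [hE.apply_apply hS hT, hE.apply_apply hT hS, Set.inter_comm]

/-- A vector in the range of `E S` with `S` bounded lies in the domain. -/
theorem IsSpectralMeasure.exists_graph_of_bounded (hE : IsSpectralMeasure L E) {S : Set ℝ}
    (hS : MeasurableSet S) {R : ℝ} (hR : ∀ s ∈ S, |s| ≤ R) {x : H} (hx : E S x = x) :
    ∃ y, (x, y) ∈ L.graph ∧ ‖⟪x, y⟫_ℂ‖ ≤ R * ‖x‖ ^ 2 := by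
  obtain ⟨μ, hμ, hd, hq⟩ := hE.represents x
  have hfin := isFiniteMeasure_of_eq hμ
  have hae : ∀ᵐ s ∂μ, |s| ≤ R := by
    have h0 : μ Sᶜ = 0 := by
      rw [hμ _ hS.compl, ← hx, hE.apply_apply hS.compl hS, Set.compl_inter_self, hE.empty]
      simp
    exact (measure_eq_zero_iff_ae_notMem.1 h0).mono fun s hs => hR s (by simpa using hs)
  have hint : Integrable (fun s : ℝ => s ^ 2) μ := by
    refine Integrable.of_bound (by fun_prop) (R ^ 2) (hae.mono fun s hs => ?_)
    rw [norm_pow, Real.norm_eq_abs]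
    gcongr
  have hdom := hd.2 hint
  refine ⟨_, graph_apply hdom, ?_⟩
  rw [hq hdom, norm_mul, Complex.norm_I, one_mul, Complex.norm_real]
  have := norm_integral_le_of_norm_le_const (f := fun s : ℝ => s) hae
  rwa [measureReal_def, hμ _ MeasurableSet.univ, hE.univ,
    ENNReal.toReal_ofReal (sq_nonneg _)] at this

/-- The vectors `E T x` and `E T y` are orthogonal for every `T`, so the scalar measure of `x + y`
is the sum of those of `x` and `y`. -/
theorem IsSpectralMeasure.inner_self_add (hE : IsSpectralMeasure L E) {S : Set ℝ}
    (hS : MeasurableSet S) {x x' y y' : H} (hx : (x, x') ∈ L.graph) (hy : (y, y') ∈ L.graph)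
    (hSx : E S x = x) (hSy : E S y = 0) : ⟪x + y, x' + y'⟫_ℂ = ⟪x, x'⟫_ℂ + ⟪y, y'⟫_ℂ := by
  have hxy := L.graph.add_mem hx hy
  obtain ⟨hdx, rfl⟩ := mem_domain_of_graph hx
  obtain ⟨hdy, rfl⟩ := mem_domain_of_graph hy
  obtain ⟨hdxy, hval⟩ := mem_domain_of_graph hxy
  obtain ⟨μ, hμ, hd, hq⟩ := hE.represents x
  obtain ⟨ν, hν, hd', hq'⟩ := hE.represents y
  obtain ⟨ρ, hρ, -, hq''⟩ := hE.represents (x + y)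
  have hfμ := isFiniteMeasure_of_eq hμ
  have hfν := isFiniteMeasure_of_eq hν
  have horth : ∀ T, MeasurableSet T → ⟪E T x, E T y⟫_ℂ = 0 := fun T hT => by
    rw [← hSx, hE.comm hT hS, (hE.proj S hS).inner_apply_left, hE.comm hS hT, hSy, map_zero,
      inner_zero_right]
  have hsum : ρ = μ + ν := by
    ext T hT
    rw [Measure.add_apply, hρ T hT, hμ T hT, hν T hT, ← ENNReal.ofReal_add (sq_nonneg _)
      (sq_nonneg _), map_add]
    congr 1
    have := norm_add_sq_eq_norm_sq_add_norm_sq_of_inner_eq_zero (𝕜 := ℂ) (E T x) (E T y)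
      (horth T hT)
    simpa only [sq] using this
  -- Domination by `s ^ 2 + 1`, integrable since the measure is finite.
  have hid : ∀ {m : Measure ℝ} [IsFiniteMeasure m], Integrable (fun s : ℝ => s ^ 2) m →
      Integrable (fun s : ℝ => s) m := fun {m} _ hm => by
    refine Integrable.mono' (hm.add (integrable_const (1 : ℝ))) (by fun_prop)
      (Eventually.of_forall fun s => ?_)
    simp only [Pi.add_apply, Real.norm_eq_abs]
    nlinarith [sq_abs s, sq_nonneg (|s| - 1)]
  rw [← hval, hq'' hdxy, hq hdx, hq' hdy, hsum,
    integral_add_measure (hid (hd.1 hdx)) (hid (hd'.1 hdy))]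
  push_cast
  ring

/-- Polarization: additivity of the quadratic form for `y` and for `i y` kills the sum and the
difference of the two cross terms. -/
theorem IsSpectralMeasure.inner_eq_zero (hE : IsSpectralMeasure L E) {S : Set ℝ}
    (hS : MeasurableSet S) {x x' y y' : H} (hx : (x, x') ∈ L.graph) (hy : (y, y') ∈ L.graph)
    (hSx : E S x = x) (hSy : E S y = 0) : ⟪y, x'⟫_ℂ = 0 := by
  have h1 := hE.inner_self_add hS hx hy hSx hSy
  have h2 := hE.inner_self_add hS hx (L.graph.smul_mem Complex.I hy) hSx
    (by rw [Prod.fst, map_smul, hSy, smul_zero])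
  simp only [inner_add_left, inner_add_right, inner_smul_left, inner_smul_right,
    Complex.conj_I] at h1 h2
  have h3 : ⟪x, y'⟫_ℂ + ⟪y, x'⟫_ℂ = 0 := by linear_combination h1
  have h4 : Complex.I * (⟪x, y'⟫_ℂ - ⟪y, x'⟫_ℂ) = 0 := by linear_combination h2
  have h5 := (mul_eq_zero.1 h4).resolve_left Complex.I_ne_zero
  linear_combination (h3 - h5) / 2

/-- `L` maps the range of `E S`, for bounded `S`, into itself. -/
theorem IsSpectralMeasure.apply_eq_of_graph (hE : IsSpectralMeasure L E) {S : Set ℝ}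
    (hS : MeasurableSet S) {x x' : H} (hx : (x, x') ∈ L.graph)
    (hSx : E S x = x) : E S x' = x' := by
  have hker : ∀ z, E S z = 0 → ⟪z, x'⟫_ℂ = 0 := fun z hz => by
    -- A vector `z` of the kernel need not lie in the domain. It is the sum of its pieces over these
    -- bounded layers, which do, and which stay in the kernel of `E S`.
    let A : ℕ → Set ℝ := fun n => {s | ⌊|s|⌋₊ = n}
    have hA : ∀ n, MeasurableSet (A n) := fun n =>
      (by fun_prop : Measurable fun s : ℝ => ⌊|s|⌋₊) (measurableSet_singleton n)
    have hdisj : Pairwise (Function.onFun Disjoint A) := fun m n hmn =>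
      Set.disjoint_left.2 fun s (hm : ⌊|s|⌋₊ = m) (hn : ⌊|s|⌋₊ = n) => hmn (hm.symm.trans hn)
    have hsum := hE.iUnion A hA hdisj z
    have huniv : ⋃ n, A n = Set.univ := Set.eq_univ_of_forall fun s => Set.mem_iUnion.2 ⟨_, rfl⟩
    rw [huniv, hE.univ] at hsum
    have hzero : ∀ n, ⟪x', E (A n) z⟫_ℂ = 0 := fun n => by
      obtain ⟨w, hw, -⟩ := hE.exists_graph_of_bounded (hA n) (R := n + 1)
        (fun s hs => by
          have h1 := (Nat.lt_floor_add_one |s|).le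
          rwa [show ⌊|s|⌋₊ = n from hs] at h1) ((hE.proj _ (hA n)).apply_apply z)
      rw [← inner_conj_symm, hE.inner_eq_zero hS hx hw hSx
        (by rw [hE.comm hS (hA n), hz, map_zero]), map_zero]
    have h2 := (innerSL ℂ x').hasSum hsum
    simp only [innerSL_apply_apply, hzero] at h2
    rw [← inner_conj_symm]
    have h3 : ⟪x', z⟫_ℂ = 0 := h2.unique hasSum_zero
    rw [h3, map_zero]
  have h1 : E S (x' - E S x') = 0 := by
    rw [map_sub, (hE.proj S hS).apply_apply, sub_self]
  have h2 : ⟪x' - E S x', x' - E S x'⟫_ℂ = 0 := by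
    rw [inner_sub_right, hker _ h1, ← (hE.proj S hS).inner_apply_left, h1, inner_zero_left,
      sub_zero]
  exact (sub_eq_zero.1 (inner_self_eq_zero.1 h2)).symm

theorem IsSpectralMeasure.isBoundedOn_range (hL : IsSkewHermitian L) (hE : IsSpectralMeasure L E)
    {S : Set ℝ} (hS : MeasurableSet S) {R : ℝ} (hR0 : 0 < R) (hR : ∀ s ∈ S, |s| ≤ R) :
    IsBoundedOn L (LinearMap.range (E S).toLinearMap) R := by
  have hfix : ∀ x ∈ LinearMap.range (E S).toLinearMap, E S x = x := by
    rintro _ ⟨u, rfl⟩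
    exact (hE.proj S hS).apply_apply u
  intro y hy
  obtain ⟨w, hw, -⟩ := hE.exists_graph_of_bounded hS hR (hfix y hy)
  have hSw := hE.apply_eq_of_graph hS hw (hfix y hy)
  refine ⟨w, ⟨w, hSw⟩, hw, ?_⟩
  obtain ⟨w', hw', -⟩ := hE.exists_graph_of_bounded hS hR hSw
  -- Only `|⟪x, L x⟫| ≤ R ‖x‖ ^ 2` is known. It is polarized at `y ± c w` with `w = L y`: for
  -- imaginary `c` the cross terms add up to modulus `4 |c| ‖w‖ ^ 2`, and `|c| = 1 / R` makes the
  -- parallelogram law give exactly `‖w‖ ≤ R ‖y‖`.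
  set c : ℂ := Complex.I * (R : ℂ)⁻¹ with hc
  have hcw := L.graph.smul_mem c hw'
  have hp : (y + c • w, w + c • w') ∈ L.graph := L.graph.add_mem hw hcw
  have hm : (y - c • w, w - c • w') ∈ L.graph := L.graph.sub_mem hw hcw
  obtain ⟨p, hp', hpn⟩ := hE.exists_graph_of_bounded hS hR (x := y + c • w)
    (by rw [map_add, map_smul, hfix y hy, hSw])
  obtain ⟨m, hm', hmn⟩ := hE.exists_graph_of_bounded hS hR (x := y - c • w)
    (by rw [map_sub, map_smul, hfix y hy, hSw])
  obtain rfl := graph_unique hp hp'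
  obtain rfl := graph_unique hm hm'
  have hcn : ‖c‖ = R⁻¹ := by
    rw [hc, norm_mul, Complex.norm_I, one_mul, norm_inv, Complex.norm_real, Real.norm_eq_abs,
      abs_of_pos hR0]
  have hpol : ⟪y + c • w, w + c • w'⟫_ℂ - ⟪y - c • w, w - c • w'⟫_ℂ =
      2 * (c * ⟪y, w'⟫_ℂ + (starRingEnd ℂ) c * ⟪w, w⟫_ℂ) := by
    simp only [inner_add_left, inner_add_right, inner_sub_left, inner_sub_right,
      inner_smul_left, inner_smul_right]
    ring
  have hskew : ⟪y, w'⟫_ℂ = -⟪w, w⟫_ℂ := by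
    have := hL.mem_graph_iff.1 hw _ _ hw'
    linear_combination this
  have hcc : (starRingEnd ℂ) c = -c := by simp [hc]
  have hval : ‖⟪y + c • w, w + c • w'⟫_ℂ - ⟪y - c • w, w - c • w'⟫_ℂ‖ = 4 * (R⁻¹ * ‖w‖ ^ 2) := by
    rw [hpol, hskew, hcc]
    have : 2 * (c * -⟪w, w⟫_ℂ + -c * ⟪w, w⟫_ℂ) = (-4 : ℂ) * (c * ⟪w, w⟫_ℂ) := by ring
    rw [this, norm_mul, norm_mul, hcn, inner_self_eq_norm_sq_to_K, norm_pow, RCLike.norm_ofReal,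
      abs_norm]
    norm_num
  have hpar := parallelogram_law_with_norm ℂ y (c • w)
  have hcw2 : ‖c • w‖ = R⁻¹ * ‖w‖ := by rw [norm_smul, hcn]
  rw [hcw2] at hpar
  have hle := (norm_sub_le _ _).trans (add_le_add hpn hmn)
  rw [hval] at hle
  have hfin : ‖w‖ ^ 2 ≤ (R * ‖y‖) ^ 2 := by
    have h1 : 4 * (R⁻¹ * ‖w‖ ^ 2) ≤ R * (2 * (‖y‖ ^ 2 + (R⁻¹ * ‖w‖) ^ 2)) := by
      rw [← hpar]; linarith
    have h2 : R * (2 * (‖y‖ ^ 2 + (R⁻¹ * ‖w‖) ^ 2)) =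
        2 * (R * ‖y‖ ^ 2) + 2 * (R⁻¹ * ‖w‖ ^ 2) := by
      field_simp
    rw [h2] at h1
    have h3 : R⁻¹ * ‖w‖ ^ 2 ≤ R * ‖y‖ ^ 2 := by linarith
    rw [inv_mul_le_iff₀ hR0] at h3
    calc _ ≤ R * (R * ‖y‖ ^ 2) := h3
      _ = _ := by ring
  exact (sq_le_sq₀ (norm_nonneg _) (by positivity)).1 hfin

theorem _root_.IsStarProjection.isClosed_range {P : H →L[ℂ] H} (hP : IsStarProjection P) :
    IsClosed (LinearMap.range P.toLinearMap : Set H) := by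
  have : (LinearMap.range P.toLinearMap : Set H) = {x | P x = x} := by
    ext x
    exact ⟨fun ⟨u, hu⟩ => hu ▸ hP.apply_apply u, fun h => ⟨x, h⟩⟩
  rw [this]
  exact isClosed_eq P.continuous continuous_id

end Spectral

end SkewExp

end

/-! ### The main theorem -/

theorem mainTheorem2 {H : Type*} [NormedAddCommGroup H] [InnerProductSpace ℂ H] [CompleteSpace H]
    (L : H →ₗ.[ℂ] H) (hL : SkewExp.IsSkewHermitian L)
    (τ : ℝ) (hτ : 0 < τ) (M : ℕ) (b α : ℤ → ℂ)
    (hα : ∀ m ∈ Finset.Icc (-(M : ℤ)) M, (α m).re ≠ 0)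
    (hR : ∀ x : ℝ, ‖SkewExp.ratFun M b α (Complex.I * x)‖ ≤ 1) :
    -- the exponential and the inverses are well defined
    (∃! U : ℝ → H →L[ℂ] H, SkewExp.IsGroupGeneratedBy L U) ∧
    SkewExp.IsGroupGeneratedBy L (SkewExp.opExp L) ∧
    (∀ m ∈ Finset.Icc (-(M : ℤ)) M,
      SkewExp.IsShiftInverse ((τ : ℂ) • L) (α m)
        (SkewExp.shiftInverse ((τ : ℂ) • L) (α m))) ∧
    -- the error bound
    (∀ Λ δ : ℝ, 0 < Λ →
      (∀ x ∈ Set.Icc (-(τ * Λ)) (τ * Λ),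
        ‖Complex.exp (Complex.I * x) - SkewExp.ratFun M b α (Complex.I * x)‖ ≤ δ) →
      (∀ u₀ : H,
        ‖SkewExp.opExp L τ u₀ - SkewExp.ratOp M b α ((τ : ℂ) • L) u₀‖ ≤
          δ * ‖u₀‖ + 2 * ‖u₀ - SkewExp.modeProj L Λ u₀‖) ∧
      -- the same with the spectral projection, which is larger if `L` has continuous spectrum
      (∀ E : Set ℝ → H →L[ℂ] H, SkewExp.IsSpectralMeasure L E → ∀ u₀ : H,
        ‖SkewExp.opExp L τ u₀ - SkewExp.ratOp M b α ((τ : ℂ) • L) u₀‖ ≤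
          δ * ‖u₀‖ + 2 * ‖u₀ - E (Set.Icc (-Λ) Λ) u₀‖)) ∧
    -- stability under repeated application
    (∀ n : ℕ, ‖SkewExp.ratOp M b α ((τ : ℂ) • L) ^ n‖ ≤ 1) := by
  have hU := hL.isGroupGeneratedBy_opExp
  have hT := hL.norm_ratOp_le hτ.ne' hα hR
  refine ⟨⟨_, hU, fun U hU' => hU'.unique hL hU⟩, hU,
    fun m hm => hL.isShiftInverse hτ.ne' (hα m hm), fun Λ δ hΛ hδ => ⟨fun u => ?_, fun E hE u => ?_⟩,
    SkewExp.norm_pow_le_one_of_norm_le_one hT⟩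
  · exact hL.norm_opExp_sub_ratOp_le_projection hτ hα hR hΛ.le hδ
      (Submodule.isClosed_topologicalClosure _) (hL.isBoundedOn_eigenmodes hΛ.le)
      (SkewExp.modeProj_mem L Λ) (SkewExp.norm_modeProj_apply_le L Λ) u
  · have hP := hE.proj _ (measurableSet_Icc (a := -Λ) (b := Λ))
    exact hL.norm_opExp_sub_ratOp_le_projection hτ hα hR hΛ.le hδ hP.isClosed_range
      (hE.isBoundedOn_range hL measurableSet_Icc hΛ fun s hs => abs_le.2 hs)
      (fun u => ⟨u, rfl⟩) hP.norm_apply_le u
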